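/- Let $d\in\mathbb N$. Let $\beta\in C^1(\mathbb R)$ with $\beta(0)=0$ and $\gamma\le\beta'\le\gamma_1$ for some $0<\gamma<\gamma_1<\infty$; let $b\in C^1(\mathbb R)$ be bounded with $b\ge b_0$ for some $b_0>0$; and let $\Phi\in C^1(\mathbb R^d)$ have bounded gradient. Set $$\eta(r):=\int_0^r\int_1^s\frac{\beta'(w)}{w\,b(w)}\,dw\,ds,\qquad r\ge 0,$$ and, for $\nu(dx)=v(x)\,dx$, $$E(\nu):=\int_{\mathbb R^d}\eta(v(x))\,dx+\int_{\mathbb R^d}\Phi(x)v(x)\,dx,$$ where the domain $D(E)$ of $E$ is the set of absolutely continuous Borel probability measures $\nu(dx)=v(x)\,dx$ on $\mathbb R^d$ with $\Phi\in L^1(\mathbb R^d;\nu)$ and $v\log v\in L^1(\mathbb R^d)$. Let $D_0$ be the set of all $\nu(dx)=v(x)\,dx\in D(E)$ with $v\in L^\infty(\mathbb R^d)\cap W^{1,1}_{\mathrm{loc}}(\mathbb R^d)$ and $\frac{\nabla v}{v}\in L^2(\mathbb R^d,\mathbb R^d;\nu)$. Let $D(\mathrm{diff}\,E)$ be the set of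 all $\nu\in D(E)$ such that for each $\varphi\in C^1_c(\mathbb R^d,\mathbb R^d)$ one has $\nu\circ(\mathrm{Id}+t\varphi)^{-1}\in D(E)$ for all small $|t|$, the derivative $$\mathrm{diff}E_\nu(\varphi):=\frac{d}{dt}E\big(\nu\circ(\mathrm{Id}+t\varphi)^{-1}\big)\Big|_{t=0}$$ exists, and $\varphi\mapsto\mathrm{diff}E_\nu(\varphi)$ is linear and continuous for the topology of $L^2(\mathbb R^d,\mathbb R^d;\nu)$. For such $\nu(dx)=v(x)\,dx$, the weighted gradient $\nabla^{\mathcal P}_bE_\nu$ is the unique element of $L^2(\mathbb R^d,\mathbb R^d;\nu)$ with $$\mathrm{diff}E_\nu(\varphi)=\int_{\mathbb R^d}\frac{1}{b(v)}\,\nabla^{\mathcal P}_bE_\nu\cdot\varphi\,d\nu\qquad\text{for all }\varphi\in C^1_c(\mathbb R^d,\mathbb R^d).$$ Then every $\nu(dx)=v(x)\,dx\in D_0$ belongs to $D(\mathrm{diff}\,E)$, so that $\nabla^{\mathcal P}_bE_\nu$ is well defined, and $\nabla^{\mathcal P}_bE_\nu\in G^\nu$, where $G^\nu$ is the closure of $\{b(v)\nabla\zeta:\zeta\in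 C_c^\infty(\mathbb R^d)\}$ in $L^2(\mathbb R^d,\mathbb R^d;\nu)$. -/

import Mathlib

open MeasureTheory Filter Topology
open scoped ContDiff Gradient

noncomputable section

namespace WeightedGradientFlow

/-- The Euclidean space `ℝ^d`. -/
abbrev Rd (d : ℕ) : Type := EuclideanSpace ℝ (Fin d)

variable {d : ℕ}

/-! ### Function spaces and weak derivatives -/

/-- Compactly supported `C^1` vector fields on `ℝ^d`. -/
def IsC1cField (φ : Rd d → Rd d) : Prop :=
  ContDiff ℝ 1 φ ∧ HasCompactSupport φ

/-- Compactly supported smooth real functions on `ℝ^d`. -/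
def IsTestFunction (ζ : Rd d → ℝ) : Prop :=
  ContDiff ℝ ∞ ζ ∧ HasCompactSupport ζ

/-- `f ∈ W^{1,1}_loc(ℝ^d)` with weak gradient `Df`. -/
structure HasWeakGradient (f : Rd d → ℝ) (Df : Rd d → Rd d) : Prop where
  locallyIntegrable : LocallyIntegrable f volume
  locallyIntegrable_grad : LocallyIntegrable Df volume
  integral_eq : ∀ ζ : Rd d → ℝ, IsTestFunction ζ →
    ∫ x, f x • ∇ ζ x = -∫ x, ζ x • Df x

/-- (A version of) the Lebesgue density `v = dν/dx` of an absolutely continuous measure `ν`. -/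
def density (ν : Measure (Rd d)) : Rd d → ℝ :=
  fun x => (ν.rnDeriv volume x).toReal

/-! ### Differential and weighted gradient of functions of probability measures -/

/-- The curve `t ↦ ν ∘ (Id + t φ)⁻¹`. -/
def pushCurve (ν : Measure (Rd d)) (φ : Rd d → Rd d) (t : ℝ) : Measure (Rd d) :=
  ν.map (fun x => x + t • φ x)

/-- `diff F_ν (φ) = d/dt F(ν ∘ (Id + t φ)⁻¹)` at `t = 0`. -/
def diffAt (F : Measure (Rd d) → ℝ) (ν : Measure (Rd d)) (φ : Rd d → Rd d) : ℝ :=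
  deriv (fun t : ℝ => F (pushCurve ν φ t)) 0

/-- `ν ∈ D(diff F)`, for a function `F` that is defined on the set `dom` of measures:
`ν` belongs to `dom`, the derivative defining `diff F_ν (φ)` exists for every compactly supported
`C^1` vector field `φ` (in particular, the curve stays in `dom` for small times), and it is a linear
function of `φ` that is continuous for the topology of `L²(ℝ^d, ℝ^d; ν)`. -/
structure MemDiffDomain (dom : Set (Measure (Rd d))) (F : Measure (Rd d) → ℝ)
    (ν : Measure (Rd d)) : Prop where
  mem : ν ∈ dom
  eventually_mem : ∀ φ, IsC1cField φ → ∀ᶠ t in 𝓝 (0 : ℝ), pushCurve ν φ t ∈ dom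
  differentiableAt : ∀ φ, IsC1cField φ →
    DifferentiableAt ℝ (fun t : ℝ => F (pushCurve ν φ t)) 0
  map_add : ∀ φ ψ, IsC1cField φ → IsC1cField ψ →
    diffAt F ν (fun x => φ x + ψ x) = diffAt F ν φ + diffAt F ν ψ
  map_smul : ∀ (c : ℝ) (φ), IsC1cField φ →
    diffAt F ν (fun x => c • φ x) = c * diffAt F ν φ
  bounded : ∃ C : ℝ, ∀ φ, IsC1cField φ → |diffAt F ν φ| ≤ C * (eLpNorm φ 2 ν).toReal

/-- `w` represents `diff F_ν` on compactly supported `C^1` vector fields with respect to the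
weighted inner product `⟨w, φ⟩_{α,ν} = ∫ α(ν)(x) w(x) · φ(x) dν(x)`, i.e. `w` is the
`α`-weighted gradient of `F` at `ν`. -/
def IsWeightedGradient (F : Measure (Rd d) → ℝ) (α : Measure (Rd d) → Rd d → ℝ)
    (ν : Measure (Rd d)) (w : Lp (Rd d) 2 ν) : Prop :=
  ∀ φ, IsC1cField φ → diffAt F ν φ = ∫ x, α ν x * inner ℝ (w x) (φ x) ∂ν

/-! ### Coefficients, energy, and the domain `D₀` -/

/-- Standing assumptions on the diffusivity `β`, the nonlinearity `b` and the potential `Φ`. -/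
structure Coefficients (β b : ℝ → ℝ) (Φ : Rd d → ℝ) : Prop where
  contDiff_beta : ContDiff ℝ 1 β
  beta_zero : β 0 = 0
  deriv_beta_bounds : ∃ γ γ₁ : ℝ, 0 < γ ∧ γ < γ₁ ∧ ∀ r, γ ≤ deriv β r ∧ deriv β r ≤ γ₁
  contDiff_b : ContDiff ℝ 1 b
  b_bounded : ∃ M : ℝ, ∀ r, |b r| ≤ M
  b_lower : ∃ b₀ : ℝ, 0 < b₀ ∧ ∀ r, b₀ ≤ b r
  contDiff_Phi : ContDiff ℝ 1 Φ
  grad_Phi_bounded : ∃ M : ℝ, ∀ x, ‖∇ Φ x‖ ≤ M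

/-- `g(s) = ∫_1^s β'(w) / (w b(w)) dw`, for `s > 0`. -/
def gFun (β b : ℝ → ℝ) (s : ℝ) : ℝ :=
  ∫ w in (1 : ℝ)..s, deriv β w / (w * b w)

/-- `η(r) = ∫_0^r g(s) ds`, for `r ≥ 0`. -/
def eta (β b : ℝ → ℝ) (r : ℝ) : ℝ :=
  ∫ s in (0 : ℝ)..r, gFun β b s

/-- The energy `E(v dx) = ∫ η(v) dx + ∫ Φ v dx`. -/
def energy (β b : ℝ → ℝ) (Φ : Rd d → ℝ) (ν : Measure (Rd d)) : ℝ :=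
  (∫ x, eta β b (density ν x)) + ∫ x, Φ x * density ν x

/-- `D(E)`: absolutely continuous probability measures `ν = v dx` with `Φ ∈ L¹(ν)` and
`v log v ∈ L¹(dx)`. -/
def energyDomain (Φ : Rd d → ℝ) : Set (Measure (Rd d)) :=
  {ν | IsProbabilityMeasure ν ∧ ν ≪ volume ∧ Integrable Φ ν ∧
    Integrable (fun x => density ν x * Real.log (density ν x)) volume}

/-- `D'_nice`: absolutely continuous probability measures `ν = v dx` such that
`v ∈ L^∞ ∩ W^{1,1}_loc` and `∇v / v ∈ L²(ℝ^d, ℝ^d; ν)`. -/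
def niceDomain (d : ℕ) : Set (Measure (Rd d)) :=
  {ν | IsProbabilityMeasure ν ∧ ν ≪ volume ∧ MemLp (density ν) ⊤ volume ∧
    ∃ Dv : Rd d → Rd d, HasWeakGradient (density ν) Dv ∧
      MemLp (fun x => (density ν x)⁻¹ • Dv x) 2 ν}

/-- `D₀ = D'_nice ∩ D(E)`. -/
def domainD0 (Φ : Rd d → ℝ) : Set (Measure (Rd d)) :=
  niceDomain d ∩ energyDomain Φ

open Classical in
/-- The weight `α(ν) = 1 / b(v)` if `ν = v dx`, and `α(ν) = 1` if `ν` is not absolutely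
continuous. -/
def weight (b : ℝ → ℝ) (ν : Measure (Rd d)) : Rd d → ℝ :=
  if ν ≪ volume then fun x => 1 / b (density ν x) else fun _ => 1

/-- `G^ν`: the closure of `{b(v) ∇ζ | ζ ∈ C_c^∞(ℝ^d)}` in `L²(ℝ^d, ℝ^d; ν)`. As `1 / b` is bounded
above and away from zero, the weighted inner product induces the usual topology of `L²`. -/
def weightedGradientFields (b : ℝ → ℝ) (ν : Measure (Rd d)) : Set (Lp (Rd d) 2 ν) :=
  closure {f | ∃ ζ : Rd d → ℝ, IsTestFunction ζ ∧
    f =ᵐ[ν] fun x => b (density ν x) • ∇ ζ x}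

end WeightedGradientFlow

end

/-! Push `ν = v dx` forward by `T = Id + tφ`, whose Jacobian `J = det (1 + t Dφ)` lies in `[1/2, 2]`
for small `t`. The new density at `T x` is `v(x) / J(x)`, so the internal energy becomes `∫ J η(v/J)
dx`. As a function of `J`, the integrand has derivative `η(r) - r η'(r) = -P(r)` at `r = v/J`, where
`P' = β'/b` and `P(0) = 0`. At `t = 0` the Jacobian has derivative `div φ`, so `diff E_ν(φ) = -∫
P(v) div φ dx + ∫ ∇Φ · φ dν`. Both differentiations under the integral are by domination.

The chain rule for weak gradients turns `-∫ P(v) div φ` into `∫ (β'/b)(v) ∇v · φ dx`. Because `∇v =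
0` almost everywhere on `{v = 0}`, this equals `∫ (β'/b)(v) (∇v/v) · φ dν`. Hence `diff E_ν(φ) = ∫ W
· φ dν` with `W = (β'/b)(v) ∇v/v + ∇Φ`, which lies in `L²(ν)`. Cauchy-Schwarz gives continuity in
`φ`, and the weighted gradient is `b(v) W`. It is the only one because fields `ζ e`, with `ζ` a test
function and `e` a fixed vector, already determine it.

Since `b` is bounded, membership in `G^ν` reduces to showing that `W` is an `L²(ν)`-limit of
gradients of test functions. Boundedness of `v` gives `ν ≤ M dx`, so `L²(dx)` approximation is
enough, and also `v ∈ H¹`. Formally `(β'/b)(v) ∇v/v` is the gradient of `g(v)`, but `g` is singular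
at `0`. Replacing `1/v` by `1/(|v| + 1/(n+1))` gives bounded continuous multiples of `∇v`. These are
limits of gradients by approximating `v` in `H¹`, and they converge to the singular field under a
multiple of `|∇v/v| ∈ L²(ν)`. The term `∇Φ` is reached by cutting off `Φ`: its linear growth is
balanced by the bound on `|x| |∇χ_n(x)|`. -/

noncomputable section

namespace WeightedGradientFlow

open scoped ENNReal Convolution

variable {d : ℕ}

/-! ### Mollification in `L^p`. -/

section Mollification

variable {F : Type*} [NormedAddCommGroup F]

/-- Translations are measure preserving and depend continuously on `y` in the compact-open topology;
composition in `L^p`, `p < ∞`, is continuous in such maps. -/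
theorem tendsto_eLpNorm_translate_sub {p : ℝ≥0∞} (hp : 1 ≤ p) (hp' : p ≠ ⊤) {f : Rd d → F}
    (hf : MemLp f p volume) :
    Tendsto (fun y => eLpNorm (fun x => f (x - y) - f x) p volume) (𝓝 0) (𝓝 0) := by
  have : Fact (1 ≤ p) := ⟨hp⟩
  let g : Rd d → C(Rd d, Rd d) :=
    fun y => ⟨fun x => x - y, by fun_prop⟩
  have hg : Continuous g := by
    refine ContinuousMap.continuous_of_continuous_uncurry _ ?_
    change Continuous fun z : Rd d × Rd d => z.2 - z.1
    fun_prop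
  have hm : ∀ y, MeasurePreserving (g y) volume volume := fun y =>
    measurePreserving_sub_right volume y
  have h := (continuous_const (y := hf.toLp f)).compMeasurePreservingLp hg hm hp'
  have h0 := h.tendsto 0
  rw [tendsto_iff_edist_tendsto_0] at h0
  refine h0.congr fun y => ?_
  rw [Lp.edist_def]
  refine eLpNorm_congr_ae ?_
  have h1 := Lp.coeFn_compMeasurePreserving (hf.toLp f) (hm y)
  have h2 := Lp.coeFn_compMeasurePreserving (hf.toLp f) (hm 0)
  have h3 := (hm y).quasiMeasurePreserving.ae_eq_comp hf.coeFn_toLp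
  have h4 := (hm 0).quasiMeasurePreserving.ae_eq_comp hf.coeFn_toLp
  filter_upwards [h1, h2, h3, h4] with x e1 e2 e3 e4
  simp only [Pi.sub_apply, e1, e2, e3, e4]
  simp [g]

variable [NormedSpace ℝ F] [CompleteSpace F]

/-- The normalized bump is a probability density, so the left side is the norm of an average of `f
(x - y) - f x`, and `L¹ ≤ L^p` for a probability measure. -/
theorem enorm_normed_convolution_sub_le {p : ℝ≥0∞} (hp : 1 ≤ p) (φ : ContDiffBump (0 : Rd d))
    {f : Rd d → F} (hf : LocallyIntegrable f volume) (hfm : StronglyMeasurable f) (x : Rd d) :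
    ‖(φ.normed volume ⋆[ContinuousLinearMap.lsmul ℝ ℝ] f) x - f x‖ₑ ≤
      eLpNorm (fun y => f (x - y) - f x) p
        (volume.withDensity fun y => ENNReal.ofReal (φ.normed volume y)) := by
  set κ : Measure (Rd d) := volume.withDensity fun y => ENNReal.ofReal (φ.normed volume y)
  have hκ : IsProbabilityMeasure κ := by
    constructor
    rw [withDensity_apply _ MeasurableSet.univ, Measure.restrict_univ,
      ← ofReal_integral_eq_lintegral_ofReal φ.integrable_normed
        (ae_of_all _ φ.nonneg_normed), φ.integral_normed, ENNReal.ofReal_one]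
  have hconv : Integrable (fun y => φ.normed volume y • f (x - y)) volume :=
    φ.hasCompactSupport_normed.convolutionExists_left (ContinuousLinearMap.lsmul ℝ ℝ)
      φ.continuous_normed hf x
  have hconst : Integrable (fun y => φ.normed volume y • f x) volume :=
    φ.integrable_normed.smul_const _
  have heq : (φ.normed volume ⋆[ContinuousLinearMap.lsmul ℝ ℝ] f) x - f x =
      ∫ y, φ.normed volume y • (f (x - y) - f x) := by
    simp_rw [smul_sub]
    rw [integral_sub hconv hconst, integral_smul_const, φ.integral_normed, one_smul]
    rfl
  rw [heq]
  refine (enorm_integral_le_lintegral_enorm _).trans ?_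
  refine le_trans (le_of_eq ?_) (eLpNorm_le_eLpNorm_of_exponent_le (μ := κ) hp ?_)
  · rw [eLpNorm_one_eq_lintegral_enorm, lintegral_withDensity_eq_lintegral_mul₀]
    · refine lintegral_congr fun y => ?_
      rw [enorm_smul, Pi.mul_apply, Real.enorm_eq_ofReal (φ.nonneg_normed y)]
    · exact φ.continuous_normed.measurable.ennreal_ofReal.aemeasurable
    · exact ((hfm.comp_measurable (measurable_const.sub measurable_id)).sub
        stronglyMeasurable_const).enorm.aemeasurable
  · exact ((hfm.comp_measurable (measurable_const.sub measurable_id)).sub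
        stronglyMeasurable_const).aestronglyMeasurable

/-- Integrate the pointwise bound in `x` and exchange integrals by Tonelli: only translations by `y`
in the support of the bump contribute. -/
theorem eLpNorm_normed_convolution_sub_le {p : ℝ≥0∞} (hp : 1 ≤ p) (hp' : p ≠ ⊤)
    (φ : ContDiffBump (0 : Rd d)) {f : Rd d → F} (hf : MemLp f p volume) {ε : ℝ≥0∞}
    (h : ∀ y ∈ Metric.ball (0 : Rd d) φ.rOut,
      eLpNorm (fun x => f (x - y) - f x) p volume ≤ ε) :
    eLpNorm (φ.normed volume ⋆[ContinuousLinearMap.lsmul ℝ ℝ] f - f) p volume ≤ ε := by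
  -- Tonelli needs joint measurability of `f (x - y)`, which is immediate for an honestly measurable
  -- representative.
  wlog hfm : StronglyMeasurable f generalizing f
  · have hmk := hf.1.ae_eq_mk
    have hconv := convolution_congr (ContinuousLinearMap.lsmul ℝ ℝ)
      (ae_eq_refl (μ := (volume : Measure (Rd d))) (φ.normed volume)) hmk
    rw [hconv]
    have := this ((memLp_congr_ae hmk).1 hf) (fun y hy => ?_) hf.1.stronglyMeasurable_mk
    · rwa [eLpNorm_congr_ae (EventuallyEq.rfl.sub hmk)]
    · refine le_trans (le_of_eq ?_) (h y hy)
      refine eLpNorm_congr_ae ?_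
      have h3 := (measurePreserving_sub_right (volume : Measure (Rd d)) y).quasiMeasurePreserving
        |>.ae_eq_comp hmk
      filter_upwards [hmk, h3] with x e1 e2
      simp only [Function.comp_apply] at e2
      rw [e1, e2]
  have hp0 : p ≠ 0 := (one_pos.trans_le hp).ne'
  have hpr : 0 < p.toReal := ENNReal.toReal_pos hp0 hp'
  set κ : Measure (Rd d) := volume.withDensity fun y => ENNReal.ofReal (φ.normed volume y)
  have hκ : κ Set.univ = 1 := by
    rw [withDensity_apply _ MeasurableSet.univ, Measure.restrict_univ,
      ← ofReal_integral_eq_lintegral_ofReal φ.integrable_normed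
        (ae_of_all _ φ.nonneg_normed), φ.integral_normed, ENNReal.ofReal_one]
  have : IsProbabilityMeasure κ := ⟨hκ⟩
  have hball : ∀ᵐ y ∂κ, y ∈ Metric.ball (0 : Rd d) φ.rOut := by
    rw [ae_withDensity_iff φ.continuous_normed.measurable.ennreal_ofReal]
    refine ae_of_all _ fun y hy => ?_
    rw [← φ.support_normed_eq (μ := volume), Function.mem_support]
    intro h0
    simp [h0] at hy
  rw [eLpNorm_eq_lintegral_rpow_enorm_toReal hp0 hp', one_div, ENNReal.rpow_inv_le_iff hpr]
  calc ∫⁻ x, ‖(φ.normed volume ⋆[ContinuousLinearMap.lsmul ℝ ℝ] f - f) x‖ₑ ^ p.toReal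
      ≤ ∫⁻ x, ∫⁻ y, ‖f (x - y) - f x‖ₑ ^ p.toReal ∂κ := by
        refine lintegral_mono fun x => ?_
        have := enorm_normed_convolution_sub_le hp φ (hf.locallyIntegrable hp) hfm x
        rw [eLpNorm_eq_lintegral_rpow_enorm_toReal hp0 hp', one_div,
          ENNReal.le_rpow_inv_iff hpr] at this
        exact this
    _ = ∫⁻ y, (∫⁻ x, ‖f (x - y) - f x‖ₑ ^ p.toReal) ∂κ := by
        rw [lintegral_lintegral_swap]
        refine AEMeasurable.pow_const (f := fun z : Rd d × Rd d => ‖f (z.1 - z.2) - f z.1‖ₑ) ?_ _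
        exact ((hfm.comp_measurable (measurable_fst.sub measurable_snd)).sub
          (hfm.comp_measurable measurable_fst)).enorm.aemeasurable
    _ ≤ ∫⁻ _, ε ^ p.toReal ∂κ := by
        refine lintegral_mono_ae ?_
        filter_upwards [hball] with y hy
        have := h y hy
        rwa [eLpNorm_eq_lintegral_rpow_enorm_toReal hp0 hp', one_div,
          ENNReal.rpow_inv_le_iff hpr] at this
    _ = ε ^ p.toReal := by rw [lintegral_const, hκ, mul_one]

theorem tendsto_eLpNorm_normed_convolution_sub {p : ℝ≥0∞} (hp : 1 ≤ p) (hp' : p ≠ ⊤)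
    {φ : ℕ → ContDiffBump (0 : Rd d)} (hφ : Tendsto (fun n => (φ n).rOut) atTop (𝓝 0))
    {f : Rd d → F} (hf : MemLp f p volume) :
    Tendsto (fun n => eLpNorm ((φ n).normed volume ⋆[ContinuousLinearMap.lsmul ℝ ℝ] f - f) p
      volume) atTop (𝓝 0) := by
  rw [ENNReal.tendsto_nhds_zero]
  intro ε hε
  have h := ENNReal.tendsto_nhds_zero.1 (tendsto_eLpNorm_translate_sub hp hp' hf) ε hε
  obtain ⟨δ, hδ, hball⟩ := Metric.eventually_nhds_iff_ball.1 h
  filter_upwards [hφ.eventually (gt_mem_nhds hδ)] with n hn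
  exact eLpNorm_normed_convolution_sub_le hp hp' _ hf fun y hy =>
    hball y (Metric.ball_subset_ball hn.le hy)

end Mollification

/-! ### Dominated convergence in `L^p` and almost everywhere convergent subsequences. -/

section LpConvergence

variable {α F : Type*} [MeasurableSpace α] {μ : Measure α} [NormedAddCommGroup F]

theorem tendsto_eLpNorm_zero_of_dominated {p : ℝ≥0∞} (hp : p ≠ 0) (hp' : p ≠ ⊤)
    {H : ℕ → α → F} {G : α → ℝ} (hH : ∀ n, AEStronglyMeasurable (H n) μ) (hG : MemLp G p μ)
    (hle : ∀ n, ∀ᵐ x ∂μ, ‖H n x‖ ≤ G x)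
    (hlim : ∀ᵐ x ∂μ, Tendsto (fun n => H n x) atTop (𝓝 0)) :
    Tendsto (fun n => eLpNorm (H n) p μ) atTop (𝓝 0) := by
  have hpr : 0 < p.toReal := ENNReal.toReal_pos hp hp'
  have key : Tendsto (fun n => ∫⁻ x, ‖H n x‖ₑ ^ p.toReal ∂μ) atTop (𝓝 (∫⁻ _, 0 ∂μ)) := by
    refine tendsto_lintegral_of_dominated_convergence' (fun x => ‖G x‖ₑ ^ p.toReal)
      (fun n => (hH n).enorm.pow_const _) (fun n => ?_)
      (lintegral_rpow_enorm_lt_top_of_eLpNorm_lt_top hp hp' hG.2).ne ?_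
    · filter_upwards [hle n] with x hx
      refine ENNReal.rpow_le_rpow ?_ hpr.le
      rw [enorm_le_iff_norm_le, Real.norm_eq_abs]
      exact hx.trans (le_abs_self _)
    · filter_upwards [hlim] with x hx
      have h1 : Tendsto (fun n => ‖H n x‖ₑ) atTop (𝓝 0) := by
        simpa using hx.enorm
      simpa [ENNReal.zero_rpow_of_pos hpr] using h1.ennrpow_const p.toReal
  rw [lintegral_zero] at key
  have h2 := key.ennrpow_const (1 / p.toReal)
  rw [ENNReal.zero_rpow_of_pos (by positivity)] at h2
  refine h2.congr fun n => ?_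
  rw [eLpNorm_eq_lintegral_rpow_enorm_toReal hp hp']

theorem exists_subseq_tendsto_ae_of_eLpNorm {p : ℝ≥0∞} (hp : p ≠ 0)
    {f : ℕ → α → F} {g : α → F} (hf : ∀ n, AEStronglyMeasurable (f n) μ)
    (hg : AEStronglyMeasurable g μ)
    (h : Tendsto (fun n => eLpNorm (f n - g) p μ) atTop (𝓝 0)) :
    ∃ ns : ℕ → ℕ, StrictMono ns ∧ ∀ᵐ x ∂μ, Tendsto (fun i => f (ns i) x) atTop (𝓝 (g x)) :=
  (tendstoInMeasure_of_tendsto_eLpNorm hp hf hg h).exists_seq_tendsto_ae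

end LpConvergence

/-! ### Classical gradients, divergence and integration by parts. -/

section Gradient

theorem contDiff_gradient {f : Rd d → ℝ} {n m : WithTop ℕ∞} (hf : ContDiff ℝ n f)
    (h : m + 1 ≤ n) : ContDiff ℝ m (∇ f) :=
  (InnerProductSpace.toDual ℝ (Rd d)).symm.contDiff.comp (hf.fderiv_right h)

theorem continuous_gradient_of_contDiff {f : Rd d → ℝ} (hf : ContDiff ℝ 1 f) :
    Continuous (∇ f) :=
  (contDiff_gradient (m := 0) hf (by simp)).continuous

theorem hasCompactSupport_gradient {f : Rd d → ℝ} (hf : HasCompactSupport f) :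
    HasCompactSupport (∇ f) :=
  (hf.fderiv ℝ).comp_left (g := (InnerProductSpace.toDual ℝ (Rd d)).symm) (map_zero _)

theorem gradient_mul {f g : Rd d → ℝ} {x : Rd d} (hf : DifferentiableAt ℝ f x)
    (hg : DifferentiableAt ℝ g x) :
    ∇ (fun y => f y * g y) x = f x • ∇ g x + g x • ∇ f x := by
  unfold gradient
  rw [fderiv_fun_mul hf hg]
  simp

theorem gradient_comp_of_hasDerivAt {f : Rd d → ℝ} {K : ℝ → ℝ} {k : ℝ} {x : Rd d}
    (hK : HasDerivAt K k (f x)) (hf : DifferentiableAt ℝ f x) :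
    ∇ (fun y => K (f y)) x = k • ∇ f x := by
  have h : fderiv ℝ (fun y => K (f y)) x = k • fderiv ℝ f x :=
    (hK.comp_hasFDerivAt x hf.hasFDerivAt).fderiv
  unfold gradient
  rw [h]
  simp

theorem IsTestFunction.contDiff_one {ζ : Rd d → ℝ} (h : IsTestFunction ζ) : ContDiff ℝ 1 ζ :=
  h.1.of_le (by exact_mod_cast le_top)

theorem IsTestFunction.continuous_gradient {ζ : Rd d → ℝ} (h : IsTestFunction ζ) :
    Continuous (∇ ζ) :=
  continuous_gradient_of_contDiff h.contDiff_one

theorem IsTestFunction.mul {ζ χ : Rd d → ℝ} (h : IsTestFunction ζ) (h' : IsTestFunction χ) :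
    IsTestFunction (fun x => ζ x * χ x) :=
  ⟨h.1.mul h'.1, h.2.mul_right⟩

/-- The divergence of a vector field on `ℝ^d`. -/
def divergence (φ : Rd d → Rd d) (x : Rd d) : ℝ :=
  ∑ i, fderiv ℝ φ x (EuclideanSpace.single i 1) i

theorem IsC1cField.continuous_divergence {φ : Rd d → Rd d} (h : IsC1cField φ) :
    Continuous (divergence φ) := by
  unfold divergence
  have := h.1.continuous_fderiv one_ne_zero
  fun_prop

theorem IsC1cField.hasCompactSupport_divergence {φ : Rd d → Rd d} (h : IsC1cField φ) :
    HasCompactSupport (divergence φ) :=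
  (h.2.fderiv ℝ).comp_left (g := fun A : Rd d →L[ℝ] Rd d =>
    ∑ i, A (EuclideanSpace.single i 1) i) (by simp)

theorem integral_mul_fderiv_eq_neg {f g : Rd d → ℝ} (hf : ContDiff ℝ 1 f) (hg : ContDiff ℝ 1 g)
    (hc : HasCompactSupport g) (v : Rd d) :
    ∫ x, f x * fderiv ℝ g x v = -∫ x, fderiv ℝ f x v * g x := by
  have h1 : Continuous fun x => fderiv ℝ f x v :=
    (hf.continuous_fderiv one_ne_zero).clm_apply continuous_const
  have h2 : Continuous fun x => fderiv ℝ g x v :=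
    (hg.continuous_fderiv one_ne_zero).clm_apply continuous_const
  refine integral_mul_fderiv_eq_neg_fderiv_mul_of_integrable ?_ ?_ ?_
    (fun x _ => hf.differentiable one_ne_zero x) (fun x _ => hg.differentiable one_ne_zero x)
  · exact (h1.mul hg.continuous).integrable_of_hasCompactSupport hc.mul_left
  · exact (hf.continuous.mul h2).integrable_of_hasCompactSupport
      (HasCompactSupport.mul_left (hc.fderiv_apply ℝ v))
  · exact (hf.continuous.mul hg.continuous).integrable_of_hasCompactSupport hc.mul_left

/-- One-dimensional integration by parts in each coordinate; the compact support of `φ` alone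
removes the boundary terms. -/
theorem integral_mul_divergence_of_contDiff {f : Rd d → ℝ} (hf : ContDiff ℝ 1 f)
    {φ : Rd d → Rd d} (hφ : IsC1cField φ) :
    ∫ x, f x * divergence φ x = -∫ x, inner ℝ (∇ f x) (φ x) := by
  have hφi : ∀ i, ContDiff ℝ 1 fun x => φ x i := fun i => by
    have := hφ.1
    fun_prop
  have hci : ∀ i, HasCompactSupport fun x => φ x i := fun i =>
    hφ.2.comp_left (g := fun y : Rd d => y i) rfl
  have hfd : ∀ i x, fderiv ℝ (fun x => φ x i) x = (EuclideanSpace.proj i).comp (fderiv ℝ φ x) :=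
    fun i x => ((EuclideanSpace.proj i : Rd d →L[ℝ] ℝ).hasFDerivAt.comp x
      (hφ.1.differentiable one_ne_zero x).hasFDerivAt).fderiv
  have hin : ∀ x, inner ℝ (∇ f x) (φ x) =
      ∑ i, fderiv ℝ f x (EuclideanSpace.single i 1) * φ x i := by
    intro x
    rw [inner_gradient_left]
    conv_lhs => rw [← (EuclideanSpace.basisFun (Fin d) ℝ).sum_repr (φ x), map_sum]
    refine Finset.sum_congr rfl fun i _ => ?_
    simp [mul_comm]
  have h1 : ∀ i, Continuous fun x => fderiv ℝ f x (EuclideanSpace.single i 1) := fun i =>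
    (hf.continuous_fderiv one_ne_zero).clm_apply continuous_const
  have h2 : ∀ i, Continuous fun x => fderiv ℝ (fun x => φ x i) x (EuclideanSpace.single i 1) :=
    fun i => ((hφi i).continuous_fderiv one_ne_zero).clm_apply continuous_const
  simp_rw [hin, divergence, Finset.mul_sum]
  rw [integral_finsetSum _ fun i _ => ?_, integral_finsetSum _ fun i _ => ?_,
    ← Finset.sum_neg_distrib]
  · refine Finset.sum_congr rfl fun i _ => ?_
    rw [← integral_mul_fderiv_eq_neg hf (hφi i) (hci i)]
    refine integral_congr_ae (ae_of_all _ fun x => ?_)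
    simp [hfd]
  · exact ((h1 i).mul (hφi i).continuous).integrable_of_hasCompactSupport (hci i).mul_left
  · have := (hf.continuous.mul (h2 i)).integrable_of_hasCompactSupport (μ := volume)
      (HasCompactSupport.mul_left ((hci i).fderiv_apply ℝ _))
    refine this.congr (ae_of_all _ fun x => ?_)
    simp [hfd]

theorem hasWeakGradient_of_contDiff {f : Rd d → ℝ} (hf : ContDiff ℝ 1 f) :
    HasWeakGradient f (∇ f) where
  locallyIntegrable := hf.continuous.locallyIntegrable
  locallyIntegrable_grad := (continuous_gradient_of_contDiff hf).locallyIntegrable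
  integral_eq ζ hζ := by
    have hf' := continuous_gradient_of_contDiff hf
    have i1 : Integrable (fun x => f x • ∇ ζ x) volume :=
      (hf.continuous.smul hζ.continuous_gradient).integrable_of_hasCompactSupport
        (hasCompactSupport_gradient hζ.2).smul_left
    have i2 : Integrable (fun x => ζ x • ∇ f x) volume :=
      (hζ.1.continuous.smul hf').integrable_of_hasCompactSupport hζ.2.smul_right
    refine ext_inner_left ℝ fun v => ?_
    rw [inner_neg_right, ← integral_inner i1, ← integral_inner i2]
    simp_rw [inner_smul_right, inner_gradient_right, RCLike.conj_to_real]
    rw [integral_mul_fderiv_eq_neg hf hζ.contDiff_one hζ.2]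
    simp_rw [mul_comm]

end Gradient

/-! ### Weak gradients under cutoff and convolution. -/

section WeakGradient

/-- Test the weak gradient of `f` with `χ ζ` and expand by the product rule. -/
theorem HasWeakGradient.mul_test {f : Rd d → ℝ} {Df : Rd d → Rd d} (h : HasWeakGradient f Df)
    {χ : Rd d → ℝ} (hχ : IsTestFunction χ) :
    HasWeakGradient (fun x => χ x * f x) (fun x => χ x • Df x + f x • ∇ χ x) where
  locallyIntegrable := (h.locallyIntegrable.integrable_smul_left_of_hasCompactSupport
    hχ.1.continuous hχ.2).locallyIntegrable
  locallyIntegrable_grad :=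
    ((h.locallyIntegrable_grad.integrable_smul_left_of_hasCompactSupport
      hχ.1.continuous hχ.2).add (h.locallyIntegrable.integrable_smul_right_of_hasCompactSupport
      hχ.continuous_gradient (hasCompactSupport_gradient hχ.2))).locallyIntegrable
  integral_eq ζ hζ := by
    have hm := h.integral_eq _ (hχ.mul hζ)
    have hg : ∀ x, ∇ (fun y => χ y * ζ y) x = χ x • ∇ ζ x + ζ x • ∇ χ x := fun x =>
      gradient_mul (hχ.contDiff_one.differentiable one_ne_zero x)
        (hζ.contDiff_one.differentiable one_ne_zero x)
    have i1 : Integrable (fun x => f x • (χ x • ∇ ζ x)) volume :=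
      h.locallyIntegrable.integrable_smul_right_of_hasCompactSupport
        (hχ.1.continuous.smul hζ.continuous_gradient) hχ.2.smul_right
    have i2 : Integrable (fun x => f x • (ζ x • ∇ χ x)) volume :=
      h.locallyIntegrable.integrable_smul_right_of_hasCompactSupport
        (hζ.1.continuous.smul hχ.continuous_gradient) hζ.2.smul_right
    have i3 : Integrable (fun x => (χ x * ζ x) • Df x) volume :=
      h.locallyIntegrable_grad.integrable_smul_left_of_hasCompactSupport
        (hχ.1.continuous.mul hζ.1.continuous) hχ.2.mul_right
    simp_rw [hg, smul_add] at hm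
    rw [integral_add i1 i2] at hm
    have e1 : ∀ x, (χ x * f x) • ∇ ζ x = f x • (χ x • ∇ ζ x) := fun x => by
      rw [smul_smul, mul_comm]
    have e2 : ∀ x, ζ x • (χ x • Df x + f x • ∇ χ x) =
        (χ x * ζ x) • Df x + f x • (ζ x • ∇ χ x) := fun x => by
      rw [smul_add, smul_smul, smul_smul, smul_smul, mul_comm (ζ x), mul_comm (ζ x)]
    simp_rw [e1, e2]
    rw [integral_add i3 i2, neg_add, ← hm]
    abel

/-- The derivative falls on the kernel, and the definition of the weak gradient is then applied to
the test function `t ↦ ρ (x - t)`. -/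
theorem HasWeakGradient.gradient_convolution {f : Rd d → ℝ} {Df : Rd d → Rd d}
    (h : HasWeakGradient f Df) {ρ : Rd d → ℝ} (hρ : IsTestFunction ρ) (x : Rd d) :
    ∇ (ρ ⋆[ContinuousLinearMap.lsmul ℝ ℝ] f) x = (ρ ⋆[ContinuousLinearMap.lsmul ℝ ℝ] Df) x := by
  set ζ : Rd d → ℝ := fun t => ρ (x - t) with hζdef
  have hζ : IsTestFunction ζ := by
    refine ⟨hρ.1.comp (contDiff_const.sub contDiff_id), ?_⟩
    exact hρ.2.comp_homeomorph (Homeomorph.subLeft x)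
  have hgζ : ∀ t e, fderiv ℝ ζ t e = -fderiv ℝ ρ (x - t) e := by
    intro t e
    have h1 : HasFDerivAt (fun t : Rd d => x - t) (-ContinuousLinearMap.id ℝ (Rd d)) t :=
      (hasFDerivAt_id t).const_sub x
    have h2 := (hρ.contDiff_one.differentiable one_ne_zero (x - t)).hasFDerivAt.comp t h1
    rw [show ζ = ρ ∘ fun t => x - t from rfl, h2.fderiv]
    simp
  have hint := h.integral_eq ζ hζ
  have i1 : Integrable (fun t => f t • ∇ ζ t) volume :=
    h.locallyIntegrable.integrable_smul_right_of_hasCompactSupport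
      hζ.continuous_gradient (hasCompactSupport_gradient hζ.2)
  have hR : (ρ ⋆[ContinuousLinearMap.lsmul ℝ ℝ] Df) x = -∫ t, f t • ∇ ζ t := by
    rw [hint, neg_neg, convolution_def, ← integral_sub_left_eq_self _ volume x]
    simp [hζdef]
  rw [hR]
  refine ext_inner_right ℝ fun e => ?_
  rw [inner_gradient_left, inner_neg_left, real_inner_comm, ← integral_inner i1,
    (hρ.2.hasFDerivAt_convolution_left (ContinuousLinearMap.lsmul ℝ ℝ) hρ.contDiff_one
      h.locallyIntegrable x).fderiv, ← integral_neg]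
  have hex : ConvolutionExistsAt (fderiv ℝ ρ) f x
      ((ContinuousLinearMap.lsmul ℝ ℝ : ℝ →L[ℝ] ℝ →L[ℝ] ℝ).precompL (Rd d)) volume :=
    (hρ.2.fderiv ℝ).convolutionExists_left _ (hρ.contDiff_one.continuous_fderiv one_ne_zero)
      h.locallyIntegrable x
  rw [convolution_def, ContinuousLinearMap.integral_apply hex,
    ← integral_sub_left_eq_self _ volume x]
  refine integral_congr_ae (ae_of_all _ fun t => ?_)
  simp only [ContinuousLinearMap.precompL_apply, inner_smul_right, inner_gradient_right,
    RCLike.conj_to_real, hgζ]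
  simp [mul_comm]

end WeakGradient

/-! ### Density of test functions in Sobolev spaces. -/

section Approximation

/-- Mollify. Compact support of `f` makes the mollifications compactly supported, and the gradient
of a mollification is the mollification of `Df`. -/
theorem HasWeakGradient.exists_seq_testFunction_of_hasCompactSupport {p : ℝ≥0∞} (hp : 1 ≤ p)
    (hp' : p ≠ ⊤) {f : Rd d → ℝ} {Df : Rd d → Rd d} (h : HasWeakGradient f Df)
    (hf : MemLp f p volume) (hDf : MemLp Df p volume) (hc : HasCompactSupport f) :
    ∃ ζ : ℕ → Rd d → ℝ, (∀ n, IsTestFunction (ζ n)) ∧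
      Tendsto (fun n => eLpNorm (ζ n - f) p volume) atTop (𝓝 0) ∧
      Tendsto (fun n => eLpNorm (∇ (ζ n) - Df) p volume) atTop (𝓝 0) := by
  let ρ : ℕ → ContDiffBump (0 : Rd d) := fun n =>
    ⟨1 / (2 * (n + 1)), 1 / (n + 1), by positivity, by
      refine one_div_lt_one_div_of_lt (by positivity) ?_
      linarith [show (0 : ℝ) ≤ n from n.cast_nonneg]⟩
  have hρ : Tendsto (fun n => (ρ n).rOut) atTop (𝓝 0) :=
    tendsto_one_div_add_atTop_nhds_zero_nat
  have hρt : ∀ n, IsTestFunction ((ρ n).normed volume) := fun n =>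
    ⟨(ρ n).contDiff_normed, (ρ n).hasCompactSupport_normed⟩
  refine ⟨fun n => (ρ n).normed volume ⋆[ContinuousLinearMap.lsmul ℝ ℝ] f,
    fun n => ⟨(hρt n).2.contDiff_convolution_left _ (hρt n).1 h.locallyIntegrable,
      (hρt n).2.convolution _ hc⟩,
    tendsto_eLpNorm_normed_convolution_sub hp hp' hρ hf, ?_⟩
  refine (tendsto_eLpNorm_normed_convolution_sub hp hp' hρ hDf).congr fun n => ?_
  congr 2
  ext1 x
  exact (h.gradient_convolution (hρt n) x).symm

/-- Dilations of one fixed bump. The bound on `‖x‖ * ‖∇ (χ n) x‖` is scale invariant; it allows the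
cutoff of a function of linear growth such as `Φ`. -/
theorem exists_seq_cutoff (d : ℕ) : ∃ (χ : ℕ → Rd d → ℝ) (C : ℝ), 0 ≤ C ∧
    (∀ n, IsTestFunction (χ n)) ∧ (∀ n x, 0 ≤ χ n x ∧ χ n x ≤ 1) ∧
    (∀ x, ∀ᶠ n in atTop, χ n x = 1) ∧ (∀ n x, ‖∇ (χ n) x‖ ≤ C / (n + 1)) ∧
    (∀ n x, ‖x‖ * ‖∇ (χ n) x‖ ≤ C) := by
  let χ : ContDiffBump (0 : Rd d) := ⟨1, 2, one_pos, one_lt_two⟩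
  have hχt : IsTestFunction (χ : Rd d → ℝ) := ⟨χ.contDiff, χ.hasCompactSupport⟩
  obtain ⟨M, hM⟩ := hχt.continuous_gradient.bounded_above_of_compact_support
    (hasCompactSupport_gradient hχt.2)
  have hM0 : 0 ≤ M := (norm_nonneg _).trans (hM 0)
  have hpos : ∀ n : ℕ, (0 : ℝ) < n + 1 := fun n => by positivity
  have hgrad : ∀ (n : ℕ) (x : Rd d), ∇ (fun y : Rd d => χ ((n + 1 : ℝ)⁻¹ • y)) x =
      (n + 1 : ℝ)⁻¹ • ∇ (χ : Rd d → ℝ) ((n + 1 : ℝ)⁻¹ • x) := by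
    intro n x
    have h1 : HasFDerivAt (fun y : Rd d => (n + 1 : ℝ)⁻¹ • y)
        ((n + 1 : ℝ)⁻¹ • ContinuousLinearMap.id ℝ (Rd d)) x :=
      ((n + 1 : ℝ)⁻¹ • ContinuousLinearMap.id ℝ (Rd d)).hasFDerivAt
    have h2 : fderiv ℝ (fun y : Rd d => χ ((n + 1 : ℝ)⁻¹ • y)) x =
        (n + 1 : ℝ)⁻¹ • fderiv ℝ (χ : Rd d → ℝ) ((n + 1 : ℝ)⁻¹ • x) := by
      refine ((hχt.contDiff_one.differentiable one_ne_zero _).hasFDerivAt.comp x h1).fderiv.trans ?_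
      ext v
      simp
    unfold gradient
    rw [h2]
    simp
  refine ⟨fun n x => χ ((n + 1 : ℝ)⁻¹ • x), 2 * M, by positivity, fun n => ⟨?_, ?_⟩,
    fun n x => ⟨χ.nonneg, χ.le_one⟩, fun x => ?_, fun n x => ?_, fun n x => ?_⟩
  · exact χ.contDiff.comp (contDiff_id.const_smul _)
  · exact χ.hasCompactSupport.comp_homeomorph
      (Homeomorph.smulOfNeZero (n + 1 : ℝ)⁻¹ (inv_ne_zero (hpos n).ne'))
  · obtain ⟨N, hN⟩ := exists_nat_ge ‖x‖
    filter_upwards [eventually_ge_atTop N] with n hn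
    refine χ.one_of_mem_closedBall ?_
    rw [mem_closedBall_zero_iff, norm_smul, norm_inv, Real.norm_of_nonneg (hpos n).le,
      inv_mul_le_iff₀ (hpos n)]
    have : (N : ℝ) ≤ n := by exact_mod_cast hn
    change ‖x‖ ≤ (n + 1) * 1
    linarith
  · rw [hgrad, norm_smul, norm_inv, Real.norm_of_nonneg (hpos n).le, div_eq_inv_mul]
    have := hM ((n + 1 : ℝ)⁻¹ • x)
    gcongr
    linarith
  · rw [hgrad, norm_smul, ← mul_assoc, mul_comm ‖x‖, ← norm_smul]
    set y := (n + 1 : ℝ)⁻¹ • x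
    -- The bump is supported in the ball of radius `2`, so either `‖y‖ ≤ 2` or its gradient
    -- vanishes; this produces the constant `2 * M`.
    by_cases hy : ‖y‖ ≤ 2
    · exact mul_le_mul hy (hM y) (norm_nonneg _) zero_le_two
    · have hz : ∇ (χ : Rd d → ℝ) y = 0 := by
        refine image_eq_zero_of_notMem_tsupport fun hmem => hy ?_
        have h3 : tsupport (∇ (χ : Rd d → ℝ)) ⊆ tsupport (χ : Rd d → ℝ) := by
          refine closure_minimal (fun z hz => ?_) (isClosed_tsupport _)
          refine support_fderiv_subset ℝ (f := (χ : Rd d → ℝ)) fun h0 => hz ?_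
          unfold gradient
          rw [h0, map_zero]
        have := h3 hmem
        rw [χ.tsupport_eq, mem_closedBall_zero_iff] at this
        exact this
      rw [hz, norm_zero, mul_zero]
      positivity

/-- Test functions are dense in `W^{1,p}(ℝ^d)`. -/
theorem HasWeakGradient.exists_testFunction_eLpNorm_le {p : ℝ≥0∞} (hp : 1 ≤ p)
    (hp' : p ≠ ⊤) {f : Rd d → ℝ} {Df : Rd d → Rd d} (h : HasWeakGradient f Df)
    (hf : MemLp f p volume) (hDf : MemLp Df p volume) {ε : ℝ≥0∞} (hε : 0 < ε) :
    ∃ ζ : Rd d → ℝ, IsTestFunction ζ ∧ eLpNorm (ζ - f) p volume ≤ ε ∧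
      eLpNorm (∇ ζ - Df) p volume ≤ ε := by
  have hp0 : p ≠ 0 := (one_pos.trans_le hp).ne'
  obtain ⟨χ, C, hC, hχ, hχb, hχ1, hχg, -⟩ := exists_seq_cutoff d
  have m1 : ∀ n, MemLp (fun x => χ n x * f x) p volume := fun n =>
    hf.of_le ((hχ n).1.continuous.aestronglyMeasurable.mul hf.1) (ae_of_all _ fun x => by
      rw [norm_mul, Real.norm_of_nonneg (hχb n x).1]
      exact mul_le_of_le_one_left (norm_nonneg _) (hχb n x).2)
  have m2 : ∀ n, MemLp (fun x => χ n x • Df x) p volume := fun n =>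
    hDf.of_le ((hχ n).1.continuous.aestronglyMeasurable.smul hDf.1) (ae_of_all _ fun x => by
      rw [norm_smul, Real.norm_of_nonneg (hχb n x).1]
      exact mul_le_of_le_one_left (norm_nonneg _) (hχb n x).2)
  have hgC : ∀ n x, ‖∇ (χ n) x‖ ≤ C := fun n x => (hχg n x).trans
    (div_le_self hC (by linarith [show (0 : ℝ) ≤ n from n.cast_nonneg]))
  have m3 : ∀ n, MemLp (fun x => f x • ∇ (χ n) x) p volume := fun n =>
    (hf.norm.const_mul C).of_le (hf.1.smul (hχ n).continuous_gradient.aestronglyMeasurable)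
      (ae_of_all _ fun x => by
        rw [norm_smul, norm_mul, norm_norm, Real.norm_of_nonneg hC, mul_comm]
        exact mul_le_mul_of_nonneg_right (hgC n x) (norm_nonneg _))
  have t1 : Tendsto (fun n => eLpNorm ((fun x => χ n x * f x) - f) p volume) atTop (𝓝 0) := by
    refine tendsto_eLpNorm_zero_of_dominated hp0 hp' (G := fun x => ‖f x‖)
      (fun n => (m1 n).1.sub hf.1) hf.norm (fun n => ae_of_all _ fun x => ?_)
      (ae_of_all _ fun x => ?_)
    · have : χ n x * f x - f x = (χ n x - 1) * f x := by ring
      rw [Pi.sub_apply, this, norm_mul]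
      refine mul_le_of_le_one_left (norm_nonneg _) ?_
      rw [Real.norm_eq_abs, abs_le]
      constructor <;> linarith [(hχb n x).1, (hχb n x).2]
    · refine tendsto_const_nhds.congr' ?_
      filter_upwards [hχ1 x] with n hn
      simp [hn]
  have t2 : Tendsto (fun n => eLpNorm ((fun x => χ n x • Df x + f x • ∇ (χ n) x) - Df) p volume)
      atTop (𝓝 0) := by
    refine tendsto_eLpNorm_zero_of_dominated hp0 hp' (G := fun x => ‖Df x‖ + C * ‖f x‖)
      (fun n => ((m2 n).1.add (m3 n).1).sub hDf.1) (hDf.norm.add (hf.norm.const_mul C))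
      (fun n => ae_of_all _ fun x => ?_) (ae_of_all _ fun x => ?_)
    · have : χ n x • Df x + f x • ∇ (χ n) x - Df x = (χ n x - 1) • Df x + f x • ∇ (χ n) x := by
        rw [sub_smul, one_smul]; abel
      rw [Pi.sub_apply, this]
      refine (norm_add_le _ _).trans (add_le_add ?_ ?_)
      · rw [norm_smul]
        refine mul_le_of_le_one_left (norm_nonneg _) ?_
        rw [Real.norm_eq_abs, abs_le]
        constructor <;> linarith [(hχb n x).1, (hχb n x).2]
      · rw [norm_smul, mul_comm]
        exact mul_le_mul_of_nonneg_right (hgC n x) (norm_nonneg _)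
    · have l1 : Tendsto (fun n => ∇ (χ n) x) atTop (𝓝 0) := by
        refine squeeze_zero_norm (fun n => hχg n x) ?_
        exact tendsto_const_div_atTop_nhds_zero_nat C |>.comp (tendsto_add_atTop_nat 1) |>.congr
          fun n => by simp
      have l2 : Tendsto (fun n => f x • ∇ (χ n) x) atTop (𝓝 0) := by
        simpa using l1.const_smul (f x)
      refine l2.congr' ?_
      filter_upwards [hχ1 x] with n hn
      simp [hn]
  have hε2 : 0 < ε / 2 := ENNReal.half_pos hε.ne'
  obtain ⟨n, hn1, hn2⟩ := ((ENNReal.tendsto_nhds_zero.1 t1 _ hε2).and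
    (ENNReal.tendsto_nhds_zero.1 t2 _ hε2)).exists
  obtain ⟨ζ, hζ, z1, z2⟩ := (h.mul_test (hχ n)).exists_seq_testFunction_of_hasCompactSupport hp hp'
    (m1 n) ((m2 n).add (m3 n)) (hχ n).2.mul_right
  obtain ⟨m, hm1, hm2⟩ := ((ENNReal.tendsto_nhds_zero.1 z1 _ hε2).and
    (ENNReal.tendsto_nhds_zero.1 z2 _ hε2)).exists
  refine ⟨ζ m, hζ m, ?_, ?_⟩
  · rw [← sub_add_sub_cancel (ζ m) (fun x => χ n x * f x) f, ← ENNReal.add_halves ε]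
    exact (eLpNorm_add_le ((hζ m).1.continuous.aestronglyMeasurable.sub (m1 n).1)
      ((m1 n).1.sub hf.1) hp).trans (add_le_add hm1 hn1)
  · rw [← sub_add_sub_cancel (∇ (ζ m)) (fun x => χ n x • Df x + f x • ∇ (χ n) x) Df,
      ← ENNReal.add_halves ε]
    exact (eLpNorm_add_le ((hζ m).continuous_gradient.aestronglyMeasurable.sub
      ((m2 n).1.add (m3 n).1)) (((m2 n).1.add (m3 n).1).sub hDf.1) hp).trans (add_le_add hm2 hn2)

theorem HasWeakGradient.exists_seq_testFunction {p : ℝ≥0∞} (hp : 1 ≤ p)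
    (hp' : p ≠ ⊤) {f : Rd d → ℝ} {Df : Rd d → Rd d} (h : HasWeakGradient f Df)
    (hf : MemLp f p volume) (hDf : MemLp Df p volume) :
    ∃ ζ : ℕ → Rd d → ℝ, (∀ n, IsTestFunction (ζ n)) ∧
      (∀ᵐ x, Tendsto (fun n => ζ n x) atTop (𝓝 (f x))) ∧
      Tendsto (fun n => eLpNorm (ζ n - f) p volume) atTop (𝓝 0) ∧
      Tendsto (fun n => eLpNorm (∇ (ζ n) - Df) p volume) atTop (𝓝 0) := by
  -- For `n = 0` the tolerance is `⊤`, which is harmless.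
  have hpos : ∀ n : ℕ, (0 : ℝ≥0∞) < (n : ℝ≥0∞)⁻¹ := fun n =>
    ENNReal.inv_pos.2 (ENNReal.natCast_ne_top n)
  choose ζ hζ h1 h2 using fun n : ℕ => h.exists_testFunction_eLpNorm_le hp hp' hf hDf (hpos n)
  have t1 : Tendsto (fun n => eLpNorm (ζ n - f) p volume) atTop (𝓝 0) :=
    tendsto_of_tendsto_of_tendsto_of_le_of_le tendsto_const_nhds
      ENNReal.tendsto_inv_nat_nhds_zero (fun _ => zero_le) h1
  have t2 : Tendsto (fun n => eLpNorm (∇ (ζ n) - Df) p volume) atTop (𝓝 0) :=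
    tendsto_of_tendsto_of_tendsto_of_le_of_le tendsto_const_nhds
      ENNReal.tendsto_inv_nat_nhds_zero (fun _ => zero_le) h2
  obtain ⟨ns, hns, hae⟩ := exists_subseq_tendsto_ae_of_eLpNorm (one_pos.trans_le hp).ne'
    (fun n => (hζ n).1.continuous.aestronglyMeasurable) hf.1 t1
  exact ⟨fun n => ζ (ns n), fun n => hζ _, hae, t1.comp hns.tendsto_atTop,
    t2.comp hns.tendsto_atTop⟩

end Approximation

/-! ### The chain rule for weak gradients and its consequence on level sets. -/

section ChainRule

theorem norm_sub_le_of_hasDerivAt {K k : ℝ → ℝ} {L : ℝ} (hK : ∀ s, HasDerivAt K (k s) s)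
    (hL : ∀ s, |k s| ≤ L) (a b : ℝ) : |K a - K b| ≤ L * |a - b| :=
  Convex.norm_image_sub_le_of_norm_hasDerivWithin_le (s := Set.univ)
    (fun x _ => (hK x).hasDerivWithinAt) (fun x _ => hL x) convex_univ trivial trivial

theorem contDiff_one_of_hasDerivAt {K k : ℝ → ℝ} (hK : ∀ s, HasDerivAt K (k s) s)
    (hk : Continuous k) : ContDiff ℝ 1 K := by
  rw [contDiff_one_iff_deriv]
  exact ⟨fun s => (hK s).differentiableAt, by rwa [funext fun s => (hK s).deriv]⟩

/-- Pass to the limit along test functions `ζ n → f` in `W^{1,1}`. The left side converges because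
`K` is Lipschitz. On the right, the error `∇ (ζ n) - Df` is small in `L¹`, and `k (ζ n) → k f`
almost everywhere is used against the fixed `Df`. -/
theorem integral_comp_mul_divergence_of_integrable {f : Rd d → ℝ} {Df : Rd d → Rd d}
    (h : HasWeakGradient f Df) (hf : Integrable f volume) (hDf : Integrable Df volume)
    {K k : ℝ → ℝ} {L : ℝ} (hK : ∀ s, HasDerivAt K (k s) s) (hk : Continuous k)
    (hL : ∀ s, |k s| ≤ L) {φ : Rd d → Rd d} (hφ : IsC1cField φ) :
    ∫ x, K (f x) * divergence φ x = -∫ x, k (f x) * inner ℝ (Df x) (φ x) := by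
  obtain ⟨ζ, hζ, hae, t1, t2⟩ := h.exists_seq_testFunction le_rfl ENNReal.one_ne_top
    (memLp_one_iff_integrable.2 hf) (memLp_one_iff_integrable.2 hDf)
  have hL0 : 0 ≤ L := (abs_nonneg _).trans (hL 0)
  obtain ⟨A, hA⟩ := hφ.continuous_divergence.bounded_above_of_compact_support
    hφ.hasCompactSupport_divergence
  obtain ⟨B, hB⟩ := hφ.1.continuous.bounded_above_of_compact_support hφ.2
  have hA0 : 0 ≤ A := (norm_nonneg _).trans (hA 0)
  have hB0 : 0 ≤ B := (norm_nonneg _).trans (hB 0)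
  have hKc : ContDiff ℝ 1 K := contDiff_one_of_hasDerivAt hK hk
  have hφs := hφ.1.continuous.aestronglyMeasurable (μ := (volume : Measure (Rd d)))
  have hds := hφ.continuous_divergence.aestronglyMeasurable (μ := (volume : Measure (Rd d)))
  have hζi : ∀ n, Integrable (ζ n) volume := fun n =>
    (hζ n).1.continuous.integrable_of_hasCompactSupport (hζ n).2
  have hgi : ∀ n, Integrable (∇ (ζ n)) volume := fun n =>
    (hζ n).continuous_gradient.integrable_of_hasCompactSupport (hasCompactSupport_gradient (hζ n).2)
  have t1' : Tendsto (fun n => ∫ x, ‖ζ n x - f x‖) atTop (𝓝 0) := by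
    have := (ENNReal.tendsto_toReal ENNReal.zero_ne_top).comp t1
    refine this.congr fun n => ?_
    rw [Function.comp_apply, eLpNorm_one_eq_lintegral_enorm]
    exact (integral_norm_eq_lintegral_enorm ((hζi n).sub hf).1).symm
  have t2' : Tendsto (fun n => ∫ x, ‖∇ (ζ n) x - Df x‖) atTop (𝓝 0) := by
    have := (ENNReal.tendsto_toReal ENNReal.zero_ne_top).comp t2
    refine this.congr fun n => ?_
    rw [Function.comp_apply, eLpNorm_one_eq_lintegral_enorm]
    exact (integral_norm_eq_lintegral_enorm ((hgi n).sub hDf).1).symm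
  have hKle : ∀ s, |K s| ≤ |K 0| + L * |s| := fun s => by
    have := norm_sub_le_of_hasDerivAt hK hL s 0
    rw [sub_zero] at this
    linarith [abs_sub_abs_le_abs_sub (K s) (K 0)]
  have hdi : Integrable (divergence φ) volume :=
    hφ.continuous_divergence.integrable_of_hasCompactSupport hφ.hasCompactSupport_divergence
  have hKint : ∀ u : Rd d → ℝ, Integrable u volume →
      Integrable (fun x => K (u x) * divergence φ x) volume := fun u hu => by
    refine ((hdi.norm.const_mul |K 0|).add (hu.norm.const_mul (L * A))).mono'
      ((hKc.continuous.comp_aestronglyMeasurable hu.1).mul hds) (ae_of_all _ fun x => ?_)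
    rw [norm_mul, Real.norm_eq_abs]
    calc |K (u x)| * ‖divergence φ x‖ ≤ (|K 0| + L * |u x|) * ‖divergence φ x‖ := by
          gcongr; exact hKle _
      _ ≤ |K 0| * ‖divergence φ x‖ + L * A * ‖u x‖ := by
          rw [add_mul, Real.norm_eq_abs (u x), mul_assoc L, mul_assoc L, mul_comm |u x|]
          gcongr
          exact hA x
  have lim1 : Tendsto (fun n => ∫ x, K (ζ n x) * divergence φ x) atTop
      (𝓝 (∫ x, K (f x) * divergence φ x)) := by
    rw [tendsto_iff_norm_sub_tendsto_zero]
    refine squeeze_zero (fun _ => norm_nonneg _) (fun n => ?_)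
      (by simpa using t1'.const_mul (L * A))
    rw [← integral_sub (hKint _ (hζi n)) (hKint _ hf), ← integral_const_mul]
    refine norm_integral_le_of_norm_le (((hζi n).sub hf).norm.const_mul _) (ae_of_all _ fun x => ?_)
    rw [← sub_mul, norm_mul, mul_right_comm]
    exact mul_le_mul (norm_sub_le_of_hasDerivAt hK hL _ _) (hA x) (norm_nonneg _) (by positivity)
  have hkint : ∀ (u : Rd d → ℝ) (w : Rd d → Rd d), AEStronglyMeasurable u volume →
      Integrable w volume → Integrable (fun x => k (u x) * inner ℝ (w x) (φ x)) volume :=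
    fun u w hu hw => by
    refine (hw.norm.const_mul (L * B)).mono' ((hk.comp_aestronglyMeasurable hu).mul
      (hw.1.inner hφs)) (ae_of_all _ fun x => ?_)
    rw [norm_mul, mul_assoc]
    refine mul_le_mul (hL _) ((norm_inner_le_norm _ _).trans ?_) (norm_nonneg _) hL0
    rw [mul_comm]
    exact mul_le_mul_of_nonneg_right (hB x) (norm_nonneg _)
  have lim2a : Tendsto (fun n => ∫ x, k (ζ n x) * inner ℝ (∇ (ζ n) x - Df x) (φ x)) atTop
      (𝓝 0) := by
    refine squeeze_zero_norm (fun n => ?_) (by simpa using t2'.const_mul (L * B))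
    rw [← integral_const_mul]
    refine norm_integral_le_of_norm_le (((hgi n).sub hDf).norm.const_mul _)
      (ae_of_all _ fun x => ?_)
    rw [norm_mul, mul_assoc]
    refine mul_le_mul (hL _) ((norm_inner_le_norm _ _).trans ?_) (norm_nonneg _) hL0
    rw [mul_comm]
    exact mul_le_mul_of_nonneg_right (hB x) (norm_nonneg _)
  have lim2b : Tendsto (fun n => ∫ x, k (ζ n x) * inner ℝ (Df x) (φ x)) atTop
      (𝓝 (∫ x, k (f x) * inner ℝ (Df x) (φ x))) := by
    refine tendsto_integral_of_dominated_convergence (fun x => L * B * ‖Df x‖)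
      (fun n => (hkint _ _ (hζi n).1 hDf).1) (hDf.norm.const_mul _) (fun n => ae_of_all _ fun x => ?_)
      ?_
    · rw [norm_mul, mul_assoc]
      refine mul_le_mul (hL _) ((norm_inner_le_norm _ _).trans ?_) (norm_nonneg _) hL0
      rw [mul_comm]
      exact mul_le_mul_of_nonneg_right (hB x) (norm_nonneg _)
    · filter_upwards [hae] with x hx
      exact ((hk.tendsto _).comp hx).mul_const _
  have lim2 : Tendsto (fun n => ∫ x, k (ζ n x) * inner ℝ (∇ (ζ n) x) (φ x)) atTop
      (𝓝 (∫ x, k (f x) * inner ℝ (Df x) (φ x))) := by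
    rw [← zero_add (∫ x, k (f x) * inner ℝ (Df x) (φ x))]
    refine (lim2a.add lim2b).congr fun n => ?_
    rw [← integral_add (hkint _ (fun x => ∇ (ζ n) x - Df x) (hζi n).1 ((hgi n).sub hDf))
      (hkint _ _ (hζi n).1 hDf)]
    refine integral_congr_ae (ae_of_all _ fun x => ?_)
    simp only [inner_sub_left]
    ring
  refine tendsto_nhds_unique lim1 (lim2.neg.congr fun n => ?_)
  refine Eq.trans ?_ (integral_mul_divergence_of_contDiff (hKc.comp (hζ n).contDiff_one) hφ).symm
  congr 1
  refine integral_congr_ae (ae_of_all _ fun x => ?_)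
  have := gradient_comp_of_hasDerivAt (hK (ζ n x))
    ((hζ n).contDiff_one.differentiable one_ne_zero x)
  simp only [Function.comp_def, this, real_inner_smul_left]

theorem fderiv_eq_zero_of_notMem_tsupport {φ : Rd d → Rd d} {x : Rd d} (hx : x ∉ tsupport φ) :
    fderiv ℝ φ x = 0 := by
  have : x ∉ Function.support (fderiv ℝ φ) := fun h => hx (support_fderiv_subset ℝ h)
  exact Function.notMem_support.1 this

theorem divergence_eq_zero_of_notMem_tsupport {φ : Rd d → Rd d} {x : Rd d}
    (hx : x ∉ tsupport φ) : divergence φ x = 0 := by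
  simp [divergence, fderiv_eq_zero_of_notMem_tsupport hx]

/-- The chain rule for weak gradients, tested against a `C^1_c` vector field. -/
theorem HasWeakGradient.integral_comp_mul_divergence {f : Rd d → ℝ} {Df : Rd d → Rd d}
    (h : HasWeakGradient f Df)
    {K k : ℝ → ℝ} {L : ℝ} (hK : ∀ s, HasDerivAt K (k s) s) (hk : Continuous k)
    (hL : ∀ s, |k s| ≤ L) {φ : Rd d → Rd d} (hφ : IsC1cField φ) :
    ∫ x, K (f x) * divergence φ x = -∫ x, k (f x) * inner ℝ (Df x) (φ x) := by
  obtain ⟨r, hr⟩ := hφ.2.isCompact.isBounded.subset_closedBall (0 : Rd d)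
  -- A cutoff equal to `1` near the support of `φ` makes `f` and `Df` integrable without changing
  -- either integral. Absolute values are taken because `r` may be negative.
  let χ : ContDiffBump (0 : Rd d) := ⟨|r| + 1, |r| + 2, by positivity, by linarith⟩
  have hχt : IsTestFunction (χ : Rd d → ℝ) := ⟨χ.contDiff, χ.hasCompactSupport⟩
  have hsub : ∀ x ∈ tsupport φ, x ∈ Metric.ball (0 : Rd d) (|r| + 1) := fun x hx =>
    Metric.closedBall_subset_ball (by linarith [le_abs_self r]) (hr hx)
  have hχ1 : ∀ x ∈ tsupport φ, χ x = 1 := fun x hx =>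
    χ.one_of_mem_closedBall (Metric.ball_subset_closedBall (hsub x hx))
  have hχ2 : ∀ x ∈ tsupport φ, ∇ (χ : Rd d → ℝ) x = 0 := fun x hx => by
    have he : (χ : Rd d → ℝ) =ᶠ[𝓝 x] fun _ => 1 := by
      filter_upwards [Metric.isOpen_ball.mem_nhds (hsub x hx)] with y hy
      exact χ.one_of_mem_closedBall (Metric.ball_subset_closedBall hy)
    unfold gradient
    rw [he.fderiv_eq]
    simp
  have i1 : Integrable (fun x => χ x * f x) volume :=
    h.locallyIntegrable.integrable_smul_left_of_hasCompactSupport hχt.1.continuous hχt.2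
  have i2 : Integrable (fun x => χ x • Df x + f x • ∇ (χ : Rd d → ℝ) x) volume :=
    (h.locallyIntegrable_grad.integrable_smul_left_of_hasCompactSupport
      hχt.1.continuous hχt.2).add (h.locallyIntegrable.integrable_smul_right_of_hasCompactSupport
      hχt.continuous_gradient (hasCompactSupport_gradient hχt.2))
  have key := integral_comp_mul_divergence_of_integrable (h.mul_test hχt) i1 i2 hK hk hL hφ
  convert key using 1
  · refine integral_congr_ae (ae_of_all _ fun x => ?_)
    by_cases hx : x ∈ tsupport φ
    · simp [hχ1 x hx]
    · simp [divergence_eq_zero_of_notMem_tsupport hx]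
  · congr 1
    refine integral_congr_ae (ae_of_all _ fun x => ?_)
    by_cases hx : x ∈ tsupport φ
    · simp [hχ1 x hx, hχ2 x hx]
    · simp [image_eq_zero_of_notMem_tsupport hx]

theorem IsTestFunction.isC1cField_smul {ζ : Rd d → ℝ} (h : IsTestFunction ζ) (e : Rd d) :
    IsC1cField (fun x => ζ x • e) :=
  ⟨h.contDiff_one.smul contDiff_const, h.2.smul_right⟩

/-- The weak gradient vanishes almost everywhere on the zero set. -/
theorem HasWeakGradient.ae_eq_zero_of_eq_zero {f : Rd d → ℝ} {Df : Rd d → Rd d}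
    (h : HasWeakGradient f Df) : ∀ᵐ x, f x = 0 → Df x = 0 := by
  -- `K n` tends to `0` uniformly while its derivative `k n` tends boundedly to the indicator of
  -- `{0}`. In the limit the chain rule says that `Df` restricted to `{f = 0}` integrates to `0`
  -- against every test field.
  let K : ℕ → ℝ → ℝ := fun n s => Real.arctan ((n + 1) * s) / (n + 1)
  let k : ℕ → ℝ → ℝ := fun n s => 1 / (1 + ((n + 1) * s) ^ 2)
  have hpos : ∀ n : ℕ, (0 : ℝ) < n + 1 := fun n => by positivity
  have hK : ∀ n s, HasDerivAt (K n) (k n s) s := fun n s => by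
    have h1 : HasDerivAt (fun s : ℝ => (n + 1 : ℝ) * s) (n + 1) s := by
      simpa using (hasDerivAt_id s).const_mul (n + 1 : ℝ)
    have := (h1.arctan).div_const (n + 1 : ℝ)
    rwa [mul_div_cancel_right₀ _ (hpos n).ne'] at this
  have hk : ∀ n, Continuous (k n) := fun n => by
    refine continuous_const.div (by fun_prop) fun s => by positivity
  have hL : ∀ n s, |k n s| ≤ 1 := fun n s => by
    rw [abs_of_nonneg (by positivity), div_le_one (by positivity)]
    linarith [sq_nonneg ((n + 1 : ℝ) * s)]
  have hfm := h.locallyIntegrable.aestronglyMeasurable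
  have hnull : NullMeasurableSet {x | f x = 0} volume :=
    (hfm.aemeasurable.nullMeasurable (measurableSet_singleton 0))
  set g : Rd d → Rd d := Set.indicator {x | f x = 0} Df
  have hgloc : LocallyIntegrable g volume := by
    intro x
    obtain ⟨U, hU, hi⟩ := h.locallyIntegrable_grad x
    exact ⟨U, hU, hi.indicator₀ (hnull.mono_ac Measure.restrict_le_self.absolutelyContinuous)⟩
  have hzero : ∀ φ, IsC1cField φ → ∫ x, inner ℝ (g x) (φ x) = 0 := by
    intro φ hφ
    have hdi : Integrable (divergence φ) volume :=
      hφ.continuous_divergence.integrable_of_hasCompactSupport hφ.hasCompactSupport_divergence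
    have hDi : Integrable (fun x => inner ℝ (Df x) (φ x)) volume := by
      refine (h.locallyIntegrable_grad.integrable_smul_left_of_hasCompactSupport
        hφ.1.continuous.norm hφ.2.norm).mono (h.locallyIntegrable_grad.aestronglyMeasurable.inner
          hφ.1.continuous.aestronglyMeasurable) (ae_of_all _ fun x => ?_)
      rw [norm_smul, norm_norm, mul_comm]
      exact norm_inner_le_norm _ _
    have lim1 : Tendsto (fun n => ∫ x, K n (f x) * divergence φ x) atTop (𝓝 0) := by
      have hb : Tendsto (fun n : ℕ => Real.pi / 2 / (n + 1) * ∫ x, ‖divergence φ x‖) atTop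
          (𝓝 0) := by
        have : Tendsto (fun n : ℕ => Real.pi / 2 / ((n : ℝ) + 1)) atTop (𝓝 0) :=
          tendsto_const_div_atTop_nhds_zero_nat (Real.pi / 2) |>.comp (tendsto_add_atTop_nat 1) |>.congr
            fun n => by simp
        simpa using this.mul_const (∫ x, ‖divergence φ x‖)
      refine squeeze_zero_norm (fun n => ?_) hb
      rw [← integral_const_mul]
      refine norm_integral_le_of_norm_le (hdi.norm.const_mul _) (ae_of_all _ fun x => ?_)
      rw [norm_mul]
      refine mul_le_mul_of_nonneg_right ?_ (norm_nonneg _)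
      rw [Real.norm_eq_abs, abs_div, abs_of_pos (hpos n)]
      gcongr
      exact abs_le.2 ⟨(Real.neg_pi_div_two_lt_arctan _).le, (Real.arctan_lt_pi_div_two _).le⟩
    have lim2 : Tendsto (fun n => ∫ x, k n (f x) * inner ℝ (Df x) (φ x)) atTop
        (𝓝 (∫ x, inner ℝ (g x) (φ x))) := by
      refine tendsto_integral_of_dominated_convergence (fun x => ‖inner ℝ (Df x) (φ x)‖)
        (fun n => ((hk n).comp_aestronglyMeasurable hfm).mul hDi.1) hDi.norm
        (fun n => ae_of_all _ fun x => ?_) (ae_of_all _ fun x => ?_)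
      · rw [norm_mul]
        exact mul_le_of_le_one_left (norm_nonneg _) (hL n _)
      · by_cases hx : f x = 0
        · have : g x = Df x := Set.indicator_of_mem (s := {x | f x = 0}) hx _
          rw [this]
          simp [k, hx]
        · have hgx : g x = 0 := Set.indicator_of_notMem (s := {x | f x = 0}) hx _
          rw [hgx, inner_zero_left]
          have h1 : Tendsto (fun n : ℕ => ((n : ℝ) + 1) ^ 2 * f x ^ 2) atTop atTop := by
            refine Tendsto.atTop_mul_const (by positivity) ?_
            exact (tendsto_pow_atTop two_ne_zero).comp
              (tendsto_atTop_add_const_right _ _ tendsto_natCast_atTop_atTop)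
          have h2 : Tendsto (fun n : ℕ => k n (f x)) atTop (𝓝 0) := by
            have := (tendsto_atTop_add_const_left _ (1 : ℝ) h1).inv_tendsto_atTop
            refine this.congr fun n => ?_
            simp [k, mul_pow]
          simpa using h2.mul_const (inner ℝ (Df x) (φ x))
    have := tendsto_nhds_unique lim1
      (lim2.neg.congr fun n => (h.integral_comp_mul_divergence (hK n) (hk n) (hL n) hφ).symm)
    linarith
  have hae : ∀ᵐ x, g x = 0 := by
    refine ae_eq_zero_of_integral_contDiff_smul_eq_zero hgloc fun ζ hζ hc => ?_
    have hζt : IsTestFunction ζ := ⟨hζ, hc⟩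
    have hi : Integrable (fun x => ζ x • g x) volume :=
      hgloc.integrable_smul_left_of_hasCompactSupport hζ.continuous hc
    refine ext_inner_left ℝ fun e => ?_
    rw [← integral_inner hi, inner_zero_right, ← hzero _ (hζt.isC1cField_smul e)]
    refine integral_congr_ae (ae_of_all _ fun x => ?_)
    simp only [inner_smul_right, real_inner_comm]
  filter_upwards [hae] with x hx h0
  rwa [← show g x = Df x from Set.indicator_of_mem (s := {x | f x = 0}) h0 _]

end ChainRule

/-! ### The entropy `η`, its derivative `g` and the pressure. -/

section Entropy

variable {β b : ℝ → ℝ} {Φ : Rd d → ℝ}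

/-- The pressure `∫_0^r β'(w) / b(w) dw`. -/
def pressure (β b : ℝ → ℝ) (r : ℝ) : ℝ := ∫ w in (0 : ℝ)..r, deriv β w / b w

theorem Coefficients.b_pos (h : Coefficients β b Φ) (s : ℝ) : 0 < b s := by
  obtain ⟨b₀, hb₀, hb⟩ := h.b_lower
  exact hb₀.trans_le (hb s)

theorem Coefficients.continuous_ratio (h : Coefficients β b Φ) :
    Continuous fun s => deriv β s / b s :=
  (h.contDiff_beta.continuous_deriv le_rfl).div h.contDiff_b.continuous fun s => (h.b_pos s).ne'

theorem Coefficients.exists_ratio_bound (h : Coefficients β b Φ) :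
    ∃ C : ℝ, 0 ≤ C ∧ ∀ s, |deriv β s / b s| ≤ C := by
  obtain ⟨b₀, hb₀, hb⟩ := h.b_lower
  obtain ⟨γ, γ₁, hγ, hγγ, hβ⟩ := h.deriv_beta_bounds
  refine ⟨γ₁ / b₀, div_nonneg (by linarith) hb₀.le, fun s => ?_⟩
  have h1 : 0 ≤ deriv β s := hγ.le.trans (hβ s).1
  rw [abs_of_nonneg (div_nonneg h1 (h.b_pos s).le)]
  exact div_le_div₀ (by linarith) (hβ s).2 hb₀ (hb s)

theorem Coefficients.hasDerivAt_pressure (h : Coefficients β b Φ) (s : ℝ) :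
    HasDerivAt (pressure β b) (deriv β s / b s) s :=
  intervalIntegral.integral_hasDerivAt_right (h.continuous_ratio.intervalIntegrable _ _)
    h.continuous_ratio.stronglyMeasurable.stronglyMeasurableAtFilter h.continuous_ratio.continuousAt

theorem abs_pressure_le {C : ℝ} (hC : ∀ s, |deriv β s / b s| ≤ C) (r : ℝ) :
    |pressure β b r| ≤ C * |r| := by
  have := intervalIntegral.norm_integral_le_of_norm_le_const (a := 0) (b := r)
    (f := fun w => deriv β w / b w) (C := C) (fun x _ => hC x)
  rwa [sub_zero] at this

theorem Coefficients.continuousOn_integrand (h : Coefficients β b Φ) :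
    ContinuousOn (fun w => deriv β w / (w * b w)) (Set.Ioi 0) := by
  refine ContinuousOn.div (h.contDiff_beta.continuous_deriv le_rfl).continuousOn
    (continuousOn_id.mul h.contDiff_b.continuous.continuousOn) fun w hw => ?_
  exact (mul_pos hw (h.b_pos w)).ne'

theorem uIcc_subset_Ioi_zero {s t : ℝ} (hs : 0 < s) (ht : 0 < t) : Set.uIcc s t ⊆ Set.Ioi 0 :=
  fun _ hx => (lt_min hs ht).trans_le hx.1

theorem Coefficients.hasDerivAt_gFun (h : Coefficients β b Φ) {s : ℝ} (hs : 0 < s) :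
    HasDerivAt (gFun β b) (deriv β s / (s * b s)) s :=
  intervalIntegral.integral_hasDerivAt_right
    (h.continuousOn_integrand.mono (uIcc_subset_Ioi_zero one_pos hs)).intervalIntegrable
    (h.continuousOn_integrand.stronglyMeasurableAtFilter isOpen_Ioi s hs)
    (h.continuousOn_integrand.continuousAt (Ioi_mem_nhds hs))

/-- Compare the integrand with `C / w`. This logarithmic bound makes `g` integrable at `0` and ties
`η` to the condition `v log v ∈ L¹`. -/
theorem abs_gFun_le {C : ℝ}
    (hC : ∀ s, |deriv β s / b s| ≤ C) {s : ℝ} (hs : 0 < s) :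
    |gFun β b s| ≤ C * |Real.log s| := by
  have hi : IntervalIntegrable (fun w : ℝ => C * w⁻¹) volume 1 s :=
    (ContinuousOn.intervalIntegrable ((continuousOn_inv₀.mono fun x hx =>
      (uIcc_subset_Ioi_zero one_pos hs hx).ne'))).const_mul C
  have h1 := intervalIntegral.norm_integral_le_abs_of_norm_le (μ := volume) (a := 1) (b := s)
    (f := fun w => deriv β w / (w * b w)) (g := fun w => C * w⁻¹) ?_ hi
  · rw [intervalIntegral.integral_const_mul, integral_inv_of_pos one_pos hs, div_one, abs_mul,
      abs_of_nonneg ((abs_nonneg _).trans (hC 0))] at h1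
    exact h1
  · refine (ae_restrict_iff' measurableSet_uIoc).2 (ae_of_all _ fun w hw => ?_)
    have hw0 : 0 < w := uIcc_subset_Ioi_zero one_pos hs (Set.uIoc_subset_uIcc hw)
    rw [mul_comm w, ← div_div, norm_div, Real.norm_of_nonneg hw0.le, div_eq_mul_inv]
    exact mul_le_mul_of_nonneg_right (hC w) (by positivity)

theorem Coefficients.continuousOn_gFun (h : Coefficients β b Φ) :
    ContinuousOn (gFun β b) (Set.Ioi 0) := fun _ hs =>
  (h.hasDerivAt_gFun hs).continuousAt.continuousWithinAt

theorem Coefficients.intervalIntegrable_gFun (h : Coefficients β b Φ) {r : ℝ} (hr : 0 ≤ r) :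
    IntervalIntegrable (gFun β b) volume 0 r := by
  obtain ⟨C, -, hC⟩ := h.exists_ratio_bound
  have hl : IntervalIntegrable (fun s => C * Real.log s) volume 0 r :=
    intervalIntegral.intervalIntegrable_log'.const_mul C
  refine hl.mono_fun ?_ ?_
  · rw [Set.uIoc_of_le hr]
    exact (h.continuousOn_gFun.mono fun x hx => hx.1).aestronglyMeasurable measurableSet_Ioc
  · rw [Set.uIoc_of_le hr]
    refine (ae_restrict_iff' measurableSet_Ioc).2 (ae_of_all _ fun w hw => ?_)
    change ‖gFun β b w‖ ≤ ‖C * Real.log w‖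
    rw [norm_mul, Real.norm_of_nonneg ((abs_nonneg _).trans (hC 0))]
    exact abs_gFun_le hC hw.1

theorem Coefficients.hasDerivAt_eta (h : Coefficients β b Φ) {s : ℝ} (hs : 0 < s) :
    HasDerivAt (eta β b) (gFun β b s) s :=
  intervalIntegral.integral_hasDerivAt_right (h.intervalIntegrable_gFun hs.le)
    (h.continuousOn_gFun.stronglyMeasurableAtFilter isOpen_Ioi s hs)
    (h.continuousOn_gFun.continuousAt (Ioi_mem_nhds hs))

/-- Only `s = 0` is delicate; there `s log s → 0` beats the logarithmic singularity of `g`. -/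
theorem Coefficients.continuousOn_mul_gFun (h : Coefficients β b Φ) :
    ContinuousOn (fun s => s * gFun β b s) (Set.Ici 0) := by
  intro s hs
  rcases (Set.mem_Ici.1 hs).eq_or_lt with rfl | hs
  · obtain ⟨C, -, hC⟩ := h.exists_ratio_bound
    rw [ContinuousWithinAt, zero_mul]
    have hlim : Tendsto (fun s : ℝ => C * |s * Real.log s|) (𝓝[Set.Ici 0] 0) (𝓝 0) := by
      have : Continuous fun s : ℝ => C * |s * Real.log s| :=
        continuous_const.mul Real.continuous_mul_log.abs
      simpa using (this.tendsto 0).mono_left nhdsWithin_le_nhds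
    refine squeeze_zero_norm' ?_ hlim
    filter_upwards [self_mem_nhdsWithin] with x hx
    rcases (Set.mem_Ici.1 hx).eq_or_lt with rfl | hx
    · simp
    · rw [norm_mul, abs_mul, mul_left_comm]
      exact mul_le_mul_of_nonneg_left (abs_gFun_le hC hx) (norm_nonneg _)
  · exact (continuousAt_id.mul (h.hasDerivAt_gFun hs).continuousAt).continuousWithinAt

theorem Coefficients.continuous_pressure (h : Coefficients β b Φ) : Continuous (pressure β b) :=
  continuous_iff_continuousAt.2 fun s => (h.hasDerivAt_pressure s).continuousAt

/-- Both sides have derivative `g` on `(0, r)`, because `s g'(s)` is the derivative of the pressure,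
and both vanish at `0`. -/
theorem Coefficients.eta_eq (h : Coefficients β b Φ) {r : ℝ} (hr : 0 ≤ r) :
    eta β b r = r * gFun β b r - pressure β b r := by
  have key := intervalIntegral.integral_eq_sub_of_hasDerivAt_of_le hr
    (f := fun s => s * gFun β b s - pressure β b s) (f' := gFun β b)
    ((h.continuousOn_mul_gFun.mono Set.Icc_subset_Ici_self).sub h.continuous_pressure.continuousOn)
    (fun s hs => ?_) (h.intervalIntegrable_gFun hr)
  · simpa [eta, pressure] using key
  · have h1 := ((hasDerivAt_id s).mul (h.hasDerivAt_gFun hs.1)).sub (h.hasDerivAt_pressure s)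
    have hb := (h.b_pos s).ne'
    have hs0 := hs.1.ne'
    convert! h1 using 1
    simp only [id]
    field_simp
    ring

theorem Coefficients.continuousOn_eta (h : Coefficients β b Φ) :
    ContinuousOn (eta β b) (Set.Ici 0) :=
  (h.continuousOn_mul_gFun.sub h.continuous_pressure.continuousOn).congr fun _ hr => h.eta_eq hr

theorem Coefficients.abs_eta_le (h : Coefficients β b Φ) {C : ℝ}
    (hC : ∀ s, |deriv β s / b s| ≤ C) {r : ℝ} (hr : 0 ≤ r) :
    |eta β b r| ≤ C * (|r * Real.log r| + r) := by
  rcases hr.eq_or_lt with rfl | hr'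
  · simp [eta]
  rw [h.eta_eq hr]
  refine (abs_sub _ _).trans ?_
  have h1 := abs_pressure_le hC r
  have h2 := mul_le_mul_of_nonneg_left (abs_gFun_le hC hr') hr
  rw [abs_mul, abs_mul, abs_of_pos hr'] at *
  linarith

/-- The derivative of the perspective function of `η`. -/
theorem Coefficients.hasDerivAt_perspective (h : Coefficients β b Φ) {r J : ℝ} (hr : 0 ≤ r)
    (hJ : 0 < J) : HasDerivAt (fun J => J * eta β b (r / J)) (-pressure β b (r / J)) J := by
  -- The derivative of `η` is available only on `(0, ∞)`; for `r = 0` the function of `J` is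
  -- identically zero.
  rcases hr.eq_or_lt with rfl | hr'
  · simpa [eta, pressure] using hasDerivAt_const J (0 : ℝ)
  have h1 : HasDerivAt (fun J => r / J) (-r / J ^ 2) J := by
    simpa using (hasDerivAt_const J r).fun_div (hasDerivAt_id J) hJ.ne'
  have h2 := (hasDerivAt_id J).mul
    ((h.hasDerivAt_eta (div_pos hr' hJ)).comp J h1)
  convert! h2 using 1
  simp only [id, Function.comp_apply]
  rw [h.eta_eq (div_pos hr' hJ).le]
  field_simp
  ring

end Entropy

/-! ### The determinant of `1 + t A` and its derivative in `t`. -/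

section Determinant

/-- `det (1 + t A)`. -/
def detOneAdd (t : ℝ) (A : Rd d →L[ℝ] Rd d) : ℝ :=
  (ContinuousLinearMap.id ℝ (Rd d) + t • A).det

/-- The derivative of `det (1 + t A)` in `t`. -/
def detOneAddDeriv (t : ℝ) (A : Rd d →L[ℝ] Rd d) : ℝ :=
  fderiv ℝ (fun z : ℝ × (Rd d →L[ℝ] Rd d) => detOneAdd z.1 z.2) (t, A) (1, 0)

/-- The matrix of an endomorphism of `ℝ^d` in the standard basis. -/
def entries (A : Rd d →L[ℝ] Rd d) : Matrix (Fin d) (Fin d) ℝ :=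
  Matrix.of fun i j => A (EuclideanSpace.single j 1) i

/-- In matrix form the determinant is visibly polynomial in `t` and the entries, hence smooth. -/
theorem detOneAdd_eq (t : ℝ) (A : Rd d →L[ℝ] Rd d) :
    detOneAdd t A = (1 + t • entries A).det := by
  rw [detOneAdd, ContinuousLinearMap.det,
    ← LinearMap.det_toMatrix (EuclideanSpace.basisFun (Fin d) ℝ).toBasis]
  congr 1
  ext i j
  simp [LinearMap.toMatrix_apply, entries, Matrix.one_apply]

theorem contDiff_detOneAdd :
    ContDiff ℝ 1 fun z : ℝ × (Rd d →L[ℝ] Rd d) => detOneAdd z.1 z.2 := by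
  simp_rw [detOneAdd_eq, Matrix.det_apply]
  refine ContDiff.sum fun σ _ => ContDiff.const_smul _ (contDiff_prod fun i _ => ?_)
  simp only [Matrix.add_apply, Matrix.smul_apply, entries, Matrix.of_apply]
  fun_prop

theorem hasDerivAt_detOneAdd (t : ℝ) (A : Rd d →L[ℝ] Rd d) :
    HasDerivAt (fun s => detOneAdd s A) (detOneAddDeriv t A) t := by
  have h1 : HasDerivAt (fun s : ℝ => (s, A)) (1, 0) t :=
    (hasDerivAt_id t).prodMk (hasDerivAt_const t A)
  exact (contDiff_detOneAdd.differentiable one_ne_zero (t, A)).hasFDerivAt.comp_hasDerivAt t h1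

theorem continuous_detOneAddDeriv :
    Continuous fun z : ℝ × (Rd d →L[ℝ] Rd d) => detOneAddDeriv z.1 z.2 :=
  (contDiff_detOneAdd.continuous_fderiv one_ne_zero).clm_apply continuous_const

theorem detOneAdd_zero (A : Rd d →L[ℝ] Rd d) : detOneAdd 0 A = 1 := by
  simp [detOneAdd_eq]

/-- `det (1 + t A) = 1 + t tr A + t² p(t)` for a polynomial `p`. With `A = Dφ` this makes the
divergence appear. -/
theorem detOneAddDeriv_zero (A : Rd d →L[ℝ] Rd d) :
    detOneAddDeriv 0 A = ∑ i, A (EuclideanSpace.single i 1) i := by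
  refine (hasDerivAt_detOneAdd 0 A).unique ?_
  simp_rw [detOneAdd_eq]
  rw [funext fun t : ℝ => Matrix.det_one_add_smul t (entries A)]
  set p := (Matrix.det (1 + (Polynomial.X : Polynomial ℝ) • (entries A).map Polynomial.C)).divX.divX
  have h1 : HasDerivAt (fun t : ℝ => Matrix.trace (entries A) * t) (Matrix.trace (entries A)) 0 := by
    simpa using (hasDerivAt_id (0 : ℝ)).const_mul (Matrix.trace (entries A))
  have h2 := (p.hasDerivAt 0).fun_mul (hasDerivAt_pow 2 (0 : ℝ))
  have h3 := (h1.const_add 1).fun_add h2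
  simpa [Matrix.trace, entries] using h3

theorem exists_detOneAddDeriv_bound (R : ℝ) :
    ∃ C : ℝ, 0 ≤ C ∧ ∀ (t : ℝ) (A : Rd d →L[ℝ] Rd d), |t| ≤ 1 → ‖A‖ ≤ R →
      |detOneAddDeriv t A| ≤ C := by
  have hK : IsCompact (Set.Icc (-1 : ℝ) 1 ×ˢ Metric.closedBall (0 : Rd d →L[ℝ] Rd d) R) :=
    isCompact_Icc.prod (isCompact_closedBall _ _)
  obtain ⟨C, hC⟩ := hK.exists_bound_of_continuousOn
    (continuous_detOneAddDeriv (d := d)).continuousOn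
  refine ⟨max C 0, le_max_right _ _, fun t A ht hA => le_max_of_le_left (hC (t, A) ⟨?_, ?_⟩)⟩
  · exact abs_le.1 ht
  · simpa using hA

end Determinant

/-! ### The maps `Id + t φ`: bijectivity, change of variables and pushforward densities. -/

section Perturbation

theorem IsC1cField.exists_fderiv_bound {φ : Rd d → Rd d} (h : IsC1cField φ) :
    ∃ R : ℝ, 0 ≤ R ∧ ∀ x, ‖fderiv ℝ φ x‖ ≤ R := by
  obtain ⟨R, hR⟩ := (h.1.continuous_fderiv one_ne_zero).bounded_above_of_compact_support
    (h.2.fderiv ℝ)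
  exact ⟨R, (norm_nonneg _).trans (hR 0), hR⟩

/-- `t φ` is a strict contraction. This gives injectivity directly, and surjectivity from the Banach
fixed point of `x ↦ y - t φ(x)`. -/
theorem bijective_add_smul {φ : Rd d → Rd d} {R : ℝ} (hφ : Differentiable ℝ φ)
    (hR : ∀ x, ‖fderiv ℝ φ x‖ ≤ R) {t : ℝ} (ht : |t| * R < 1) :
    Function.Bijective fun x => x + t • φ x := by
  have hR0 : 0 ≤ R := (norm_nonneg _).trans (hR 0)
  have hlip : ∀ x y, ‖φ x - φ y‖ ≤ R * ‖x - y‖ := fun x y =>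
    convex_univ.norm_image_sub_le_of_norm_fderiv_le (𝕜 := ℝ) (fun z _ => hφ z) (fun z _ => hR z)
      trivial trivial
  have hlip' : ∀ x y, ‖t • φ x - t • φ y‖ ≤ |t| * R * ‖x - y‖ := fun x y => by
    rw [← smul_sub, norm_smul, mul_assoc]
    exact mul_le_mul_of_nonneg_left (hlip x y) (norm_nonneg _)
  constructor
  · intro x y hxy
    have h1 : x - y = t • φ y - t • φ x := by
      have : x + t • φ x = y + t • φ y := hxy
      rw [sub_eq_sub_iff_add_eq_add, this, add_comm]
    have h2 := hlip' y x
    rw [← h1, norm_sub_rev y x] at h2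
    have h3 : ‖x - y‖ = 0 := by nlinarith [norm_nonneg (x - y)]
    exact sub_eq_zero.1 (norm_eq_zero.1 h3)
  · intro y
    let c : NNReal := ⟨|t| * R, by positivity⟩
    have hc : ContractingWith c fun x => y - t • φ x := by
      refine ⟨by exact_mod_cast ht, LipschitzWith.of_dist_le_mul fun x z => ?_⟩
      rw [dist_eq_norm, dist_eq_norm, sub_sub_sub_cancel_left, norm_sub_rev x z]
      exact hlip' z x
    refine ⟨hc.fixedPoint, ?_⟩
    have : y - t • φ hc.fixedPoint = hc.fixedPoint := hc.fixedPoint_isFixedPt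
    change hc.fixedPoint + t • φ hc.fixedPoint = y
    nth_rewrite 1 [← this]
    abel

/-- For small `t`, `Id + t φ` is a bijection with Jacobian in `[1/2, 2]`. -/
theorem IsC1cField.exists_jacobian_bounds {φ : Rd d → Rd d} (h : IsC1cField φ) :
    ∃ δ C : ℝ, 0 < δ ∧ 0 ≤ C ∧ ∀ t : ℝ, |t| < δ →
      Function.Bijective (fun x => x + t • φ x) ∧
      ∀ x, 1 / 2 ≤ detOneAdd t (fderiv ℝ φ x) ∧ detOneAdd t (fderiv ℝ φ x) ≤ 2 ∧
        |detOneAddDeriv t (fderiv ℝ φ x)| ≤ C := by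
  obtain ⟨R, hR0, hR⟩ := h.exists_fderiv_bound
  obtain ⟨C, hC0, hC⟩ := exists_detOneAddDeriv_bound (d := d) R
  -- This radius forces `|t| ≤ 1`, `|t| R < 1` for bijectivity, and `C |t| ≤ 1/2`, which keeps the
  -- Jacobian within `1/2` of `1`.
  refine ⟨1 / (2 * (R + C + 1)), C, by positivity, hC0, fun t ht => ?_⟩
  have hp : 0 < 2 * (R + C + 1) := by positivity
  have ht' : |t| * (2 * (R + C + 1)) < 1 := by rwa [lt_div_iff₀ hp] at ht
  have ht0 := abs_nonneg t
  have ht1 : |t| ≤ 1 := by nlinarith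
  refine ⟨bijective_add_smul (h.1.differentiable one_ne_zero) hR (by nlinarith), fun x => ?_⟩
  have hd : |detOneAdd t (fderiv ℝ φ x) - 1| ≤ C * |t| := by
    have := Convex.norm_image_sub_le_of_norm_hasDerivWithin_le (s := Set.Icc (-1 : ℝ) 1)
      (f := fun s => detOneAdd s (fderiv ℝ φ x)) (f' := fun s => detOneAddDeriv s (fderiv ℝ φ x))
      (x := 0) (y := t) (C := C)
      (fun s _ => (hasDerivAt_detOneAdd s _).hasDerivWithinAt)
      (fun s hs => hC s _ (abs_le.2 hs) (hR x)) (convex_Icc _ _) (by simp) (abs_le.1 ht1)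
    simpa [detOneAdd_zero] using this
  have hd2 : |detOneAdd t (fderiv ℝ φ x) - 1| ≤ 1 / 2 := hd.trans (by nlinarith)
  rw [abs_le] at hd2
  exact ⟨by linarith, by linarith, hC t _ ht1 (hR x)⟩

theorem IsC1cField.hasFDerivAt_add_smul {φ : Rd d → Rd d} (h : IsC1cField φ) (t : ℝ) (x : Rd d) :
    HasFDerivAt (fun x => x + t • φ x) (ContinuousLinearMap.id ℝ (Rd d) + t • fderiv ℝ φ x) x :=
  (hasFDerivAt_id x).add ((h.1.differentiable one_ne_zero x).hasFDerivAt.const_smul t)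

theorem IsC1cField.continuous_add_smul {φ : Rd d → Rd d} (h : IsC1cField φ) (t : ℝ) :
    Continuous fun x => x + t • φ x :=
  continuous_id.add (h.1.continuous.const_smul t)

theorem IsC1cField.continuous_detOneAdd {φ : Rd d → Rd d} (h : IsC1cField φ) (t : ℝ) :
    Continuous fun x => detOneAdd t (fderiv ℝ φ x) :=
  contDiff_detOneAdd.continuous.comp
    (continuous_const.prodMk (h.1.continuous_fderiv one_ne_zero))

variable {φ : Rd d → Rd d} {t : ℝ}

theorem IsC1cField.setLIntegral_image (h : IsC1cField φ)
    (hinj : Function.Injective fun x => x + t • φ x)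
    (hJ : ∀ x, 0 ≤ detOneAdd t (fderiv ℝ φ x)) {s : Set (Rd d)} (hs : MeasurableSet s)
    (g : Rd d → ENNReal) :
    ∫⁻ y in (fun x => x + t • φ x) '' s, g y =
      ∫⁻ x in s, ENNReal.ofReal (detOneAdd t (fderiv ℝ φ x)) * g (x + t • φ x) := by
  rw [lintegral_image_eq_lintegral_abs_det_fderiv_mul volume hs
    (fun x _ => (h.hasFDerivAt_add_smul t x).hasFDerivWithinAt) hinj.injOn]
  refine lintegral_congr fun x => ?_
  rw [← abs_of_nonneg (hJ x)]
  rfl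

theorem IsC1cField.integral_comp (h : IsC1cField φ)
    (hbij : Function.Bijective fun x => x + t • φ x)
    (hJ : ∀ x, 0 ≤ detOneAdd t (fderiv ℝ φ x)) (g : Rd d → ℝ) :
    ∫ y, g y = ∫ x, detOneAdd t (fderiv ℝ φ x) * g (x + t • φ x) := by
  have := integral_image_eq_integral_abs_det_fderiv_smul volume MeasurableSet.univ
    (fun x _ => (h.hasFDerivAt_add_smul t x).hasFDerivWithinAt) hbij.1.injOn g
  rw [Set.image_univ, hbij.2.range_eq, Measure.restrict_univ] at this
  rw [this]
  refine integral_congr_ae (ae_of_all _ fun x => ?_)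
  simp only [smul_eq_mul]
  rw [← abs_of_nonneg (hJ x)]
  rfl

theorem IsC1cField.integrable_comp_iff (h : IsC1cField φ)
    (hbij : Function.Bijective fun x => x + t • φ x)
    (hJ : ∀ x, 0 ≤ detOneAdd t (fderiv ℝ φ x)) (g : Rd d → ℝ) :
    Integrable g volume ↔
      Integrable (fun x => detOneAdd t (fderiv ℝ φ x) * g (x + t • φ x)) volume := by
  have := integrableOn_image_iff_integrableOn_abs_det_fderiv_smul volume MeasurableSet.univ
    (fun x _ => (h.hasFDerivAt_add_smul t x).hasFDerivWithinAt) hbij.1.injOn g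
  rw [Set.image_univ, hbij.2.range_eq, integrableOn_univ, integrableOn_univ] at this
  rw [this]
  refine integrable_congr (ae_of_all _ fun x => ?_)
  simp only [smul_eq_mul]
  rw [← abs_of_nonneg (hJ x)]
  rfl

/-- For a null set `B`, the positive Jacobian integrates over the preimage of `B` to the volume of a
subset of `B`, which is zero; so the preimage is null. -/
theorem IsC1cField.pushCurve_absolutelyContinuous (h : IsC1cField φ) {ν : Measure (Rd d)}
    (hν : ν ≪ volume) (hinj : Function.Injective fun x => x + t • φ x)
    (hJ : ∀ x, 0 < detOneAdd t (fderiv ℝ φ x)) : pushCurve ν φ t ≪ volume := by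
  have hT := (h.continuous_add_smul t).measurable
  refine Measure.AbsolutelyContinuous.mk fun B hB hB0 => ?_
  rw [pushCurve, Measure.map_apply hT hB]
  refine hν ?_
  have h1 := h.setLIntegral_image hinj (fun x => (hJ x).le) (hT hB) (fun _ => 1)
  have h2 : (volume : Measure (Rd d)) ((fun x => x + t • φ x) '' ((fun x => x + t • φ x) ⁻¹' B)) =
      0 := measure_mono_null (Set.image_preimage_subset _ _) hB0
  rw [setLIntegral_one, h2] at h1
  simp only [mul_one] at h1
  have h3 := (setLIntegral_eq_zero_iff (hT hB)
    (h.continuous_detOneAdd t).measurable.ennreal_ofReal).1 h1.symm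
  refine measure_mono_null (fun x hx => ?_) h3
  simp only [Set.mem_compl_iff, Set.mem_ofPred_eq, not_forall]
  exact ⟨hx, by simpa using hJ x⟩

/-- The density of the pushforward under `Id + t φ`. -/
theorem IsC1cField.density_pushCurve (h : IsC1cField φ) {ν : Measure (Rd d)} [IsFiniteMeasure ν]
    (hν : ν ≪ volume) (hinj : Function.Injective fun x => x + t • φ x)
    (hJ : ∀ x, 0 < detOneAdd t (fderiv ℝ φ x)) :
    ∀ᵐ x, density (pushCurve ν φ t) (x + t • φ x) =
      density ν x / detOneAdd t (fderiv ℝ φ x) := by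
  have hT := h.continuous_add_smul t
  have hac := h.pushCurve_absolutelyContinuous hν hinj hJ
  have : IsFiniteMeasure (pushCurve ν φ t) := by unfold pushCurve; infer_instance
  -- Over any measurable `s`, both sides integrate to `ν s`: on the left by the change of variables
  -- and injectivity of `Id + t φ`.
  have key : (fun x => ENNReal.ofReal (detOneAdd t (fderiv ℝ φ x)) *
      (pushCurve ν φ t).rnDeriv volume (x + t • φ x)) =ᵐ[volume] ν.rnDeriv volume := by
    refine ae_eq_of_forall_setLIntegral_eq_of_sigmaFinite
      ((h.continuous_detOneAdd t).measurable.ennreal_ofReal.mul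
        ((Measure.measurable_rnDeriv _ _).comp hT.measurable)) (Measure.measurable_rnDeriv _ _)
      fun s hs _ => ?_
    have him : MeasurableSet ((fun x => x + t • φ x) '' s) :=
      (hT.measurableEmbedding hinj).measurableSet_image.2 hs
    rw [← h.setLIntegral_image hinj (fun x => (hJ x).le) hs, Measure.setLIntegral_rnDeriv hac,
      Measure.setLIntegral_rnDeriv hν, pushCurve, Measure.map_apply hT.measurable him,
      hinj.preimage_image]
  filter_upwards [key] with x hx
  have h2 := congrArg ENNReal.toReal hx
  rw [ENNReal.toReal_mul, ENNReal.toReal_ofReal (hJ x).le] at h2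
  rw [density, density, ← h2, mul_div_cancel_left₀ _ (hJ x).ne']

end Perturbation

/-! ### Basic properties of the density. -/

section Density

theorem density_nonneg (ν : Measure (Rd d)) (x : Rd d) : 0 ≤ density ν x := ENNReal.toReal_nonneg

theorem measurable_density (ν : Measure (Rd d)) : Measurable (density ν) :=
  (Measure.measurable_rnDeriv ν volume).ennreal_toReal

theorem integrable_density (ν : Measure (Rd d)) [IsFiniteMeasure ν] :
    Integrable (density ν) volume := Measure.integrable_toReal_rnDeriv

theorem integral_density_smul {ν : Measure (Rd d)} [IsFiniteMeasure ν] (hν : ν ≪ volume)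
    {F : Type*} [NormedAddCommGroup F] [NormedSpace ℝ F] (f : Rd d → F) :
    ∫ x, density ν x • f x = ∫ x, f x ∂ν :=
  integral_rnDeriv_smul hν

end Density

/-! ### Differentiating the energy along the perturbation. -/

section EnergyDerivative

variable {β b : ℝ → ℝ} {Φ : Rd d → ℝ}

theorem Coefficients.exists_lipschitz_bound (h : Coefficients β b Φ) :
    ∃ M : ℝ, 0 ≤ M ∧ (∀ x, ‖∇ Φ x‖ ≤ M) ∧ ∀ x y, ‖Φ x - Φ y‖ ≤ M * ‖x - y‖ := by
  obtain ⟨M, hM⟩ := h.grad_Phi_bounded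
  refine ⟨M, (norm_nonneg _).trans (hM 0), hM, fun x y => ?_⟩
  refine convex_univ.norm_image_sub_le_of_norm_fderiv_le (𝕜 := ℝ)
    (fun z _ => h.contDiff_Phi.differentiable one_ne_zero z) (fun z _ => ?_) trivial trivial
  rw [← toDual_gradient, LinearIsometryEquiv.norm_map]
  exact hM z

theorem Coefficients.integrable_comp_add_smul (h : Coefficients β b Φ) {ν : Measure (Rd d)}
    [IsFiniteMeasure ν] (hΦ : Integrable Φ ν) {φ : Rd d → Rd d} (hφ : IsC1cField φ) (t : ℝ) :
    Integrable (fun x => Φ (x + t • φ x)) ν := by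
  obtain ⟨M, hM0, -, hM⟩ := h.exists_lipschitz_bound
  obtain ⟨B, hB⟩ := hφ.1.continuous.bounded_above_of_compact_support hφ.2
  refine (hΦ.norm.add (integrable_const (M * (|t| * B)))).mono'
    (h.contDiff_Phi.continuous.comp (hφ.continuous_add_smul t)).aestronglyMeasurable
    (ae_of_all _ fun x => ?_)
  have h1 := hM (x + t • φ x) x
  rw [add_sub_cancel_left, norm_smul, Real.norm_eq_abs t] at h1
  have h2 : M * (|t| * ‖φ x‖) ≤ M * (|t| * B) := by gcongr; exact hB x
  have h3 := norm_sub_norm_le (Φ (x + t • φ x)) (Φ x)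
  simp only [Pi.add_apply]
  linarith

/-- `Φ` is Lipschitz and `φ` bounded, so `Φ` stays integrable. After the change of variables the
entropy density becomes `v log v - v log J`, with `log J` bounded. -/
theorem Coefficients.pushCurve_mem_energyDomain (h : Coefficients β b Φ) {ν : Measure (Rd d)}
    (hν : ν ∈ energyDomain Φ) {φ : Rd d → Rd d} (hφ : IsC1cField φ) :
    ∀ᶠ t in 𝓝 (0 : ℝ), pushCurve ν φ t ∈ energyDomain Φ := by
  obtain ⟨hp, hac, hΦ, hlog⟩ := hν
  obtain ⟨δ, C, hδ, -, hδC⟩ := hφ.exists_jacobian_bounds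
  filter_upwards [Metric.ball_mem_nhds (0 : ℝ) hδ] with t ht
  rw [mem_ball_zero_iff, Real.norm_eq_abs] at ht
  obtain ⟨hbij, hJ⟩ := hδC t ht
  have hJ0 : ∀ x, 0 < detOneAdd t (fderiv ℝ φ x) := fun x => by linarith [(hJ x).1]
  have hT := hφ.continuous_add_smul t
  refine ⟨Measure.isProbabilityMeasure_map hT.aemeasurable,
    hφ.pushCurve_absolutelyContinuous hac hbij.1 hJ0, ?_, ?_⟩
  · rw [pushCurve, integrable_map_measure h.contDiff_Phi.continuous.aestronglyMeasurable
      hT.aemeasurable]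
    exact h.integrable_comp_add_smul hΦ hφ t
  · rw [hφ.integrable_comp_iff hbij fun x => (hJ0 x).le]
    have hm : Measurable fun x => Real.log (detOneAdd t (fderiv ℝ φ x)) :=
      Real.measurable_log.comp (hφ.continuous_detOneAdd t).measurable
    have hi : Integrable (fun x => density ν x * Real.log (detOneAdd t (fderiv ℝ φ x)))
        volume := by
      -- The bound `|log J| ≤ 1` follows from `1 - 1/J ≤ log J ≤ J - 1` and `1/2 ≤ J ≤ 2`.
      refine ((integrable_density ν).norm.mul_const 1).mono'
        ((measurable_density ν).mul hm).aestronglyMeasurable (ae_of_all _ fun x => ?_)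
      rw [norm_mul]
      refine mul_le_mul_of_nonneg_left ?_ (norm_nonneg _)
      rw [Real.norm_eq_abs, abs_le]
      have h1 := Real.log_le_sub_one_of_pos (hJ0 x)
      have h2 := Real.one_sub_inv_le_log_of_pos (hJ0 x)
      have h3 : (detOneAdd t (fderiv ℝ φ x))⁻¹ ≤ 2 := by
        rw [inv_le_comm₀ (hJ0 x) two_pos]
        linarith [(hJ x).1]
      constructor <;> linarith [(hJ x).2.1]
    refine (hlog.sub hi).congr ?_
    filter_upwards [hφ.density_pushCurve hac hbij.1 hJ0] with x hx
    simp only [Pi.sub_apply]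
    rw [hx]
    rcases (density_nonneg ν x).eq_or_lt with h0 | h0
    · simp [← h0]
    · have := (hJ0 x).ne'
      rw [Real.log_div h0.ne' this]
      field_simp

theorem Coefficients.measurable_eta_comp (h : Coefficients β b Φ) {u : Rd d → ℝ}
    (hu : Measurable u) (h0 : ∀ x, 0 ≤ u x) : Measurable fun x => eta β b (u x) := by
  -- Continuity of `η` is known only on `[0, ∞)`, so it is extended by a constant to the negative
  -- axis.
  have hc : Continuous fun r : ℝ => eta β b (max r 0) :=
    h.continuousOn_eta.comp_continuous (by fun_prop) fun r => Set.mem_Ici.2 (le_max_right r 0)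
  have he : (fun x => eta β b (u x)) = (fun r => eta β b (max r 0)) ∘ u := by
    funext x
    simp [h0 x]
  rw [he]
  exact hc.measurable.comp hu

theorem Coefficients.integrable_eta_density (h : Coefficients β b Φ) {ν : Measure (Rd d)}
    (hν : ν ∈ energyDomain Φ) : Integrable (fun x => eta β b (density ν x)) volume := by
  obtain ⟨hp, hac, hΦ, hlog⟩ := hν
  obtain ⟨C, hC0, hC⟩ := h.exists_ratio_bound
  refine ((hlog.norm.add (integrable_density ν)).const_mul C).mono'
    (h.measurable_eta_comp (measurable_density ν) (density_nonneg ν)).aestronglyMeasurable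
    (ae_of_all _ fun x => h.abs_eta_le hC (density_nonneg ν x))

/-- Pulled back to the original variable, the integrand is `J η(v/J)`, whose `t`-derivative is
`-P(v/J) ∂_t J`. The linear bound on the pressure and `J ≥ 1/2` dominate it by a multiple of `v`,
which is integrable. -/
theorem Coefficients.hasDerivAt_integral_eta (h : Coefficients β b Φ) {ν : Measure (Rd d)}
    (hν : ν ∈ energyDomain Φ) {φ : Rd d → Rd d} (hφ : IsC1cField φ) :
    HasDerivAt (fun t => ∫ x, eta β b (density (pushCurve ν φ t) x))
      (-∫ x, pressure β b (density ν x) * divergence φ x) 0 := by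
  have hint := h.integrable_eta_density hν
  obtain ⟨hp, hac, hΦ, hlog⟩ := hν
  obtain ⟨δ, C, hδ, hC0, hδC⟩ := hφ.exists_jacobian_bounds
  obtain ⟨L, hL0, hL⟩ := h.exists_ratio_bound
  let J : ℝ → Rd d → ℝ := fun t x => detOneAdd t (fderiv ℝ φ x)
  let J' : ℝ → Rd d → ℝ := fun t x => detOneAddDeriv t (fderiv ℝ φ x)
  have hJm : ∀ t, Measurable (J t) := fun t => (hφ.continuous_detOneAdd t).measurable
  have hJ'm : ∀ t, Measurable (J' t) := fun t =>
    (continuous_detOneAddDeriv.comp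
      (continuous_const.prodMk (hφ.1.continuous_fderiv one_ne_zero))).measurable
  have hball : ∀ {t : ℝ}, t ∈ Metric.ball (0 : ℝ) δ → |t| < δ := fun ht => by
    simpa using ht
  have hJpos : ∀ {t : ℝ}, |t| < δ → ∀ x, 0 < J t x := fun ht x => by
    linarith [((hδC _ ht).2 x).1]
  have heq : (fun t => ∫ x, eta β b (density (pushCurve ν φ t) x)) =ᶠ[𝓝 0]
      fun t => ∫ x, J t x * eta β b (density ν x / J t x) := by
    filter_upwards [Metric.ball_mem_nhds (0 : ℝ) hδ] with t ht
    have hpos := hJpos (hball ht)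
    have hbij := (hδC t (hball ht)).1
    rw [hφ.integral_comp hbij fun x => (hpos x).le]
    refine integral_congr_ae ?_
    filter_upwards [hφ.density_pushCurve hac hbij.1 hpos] with x hx
    rw [hx]
  have main := hasDerivAt_integral_of_dominated_loc_of_deriv_le (μ := (volume : Measure (Rd d)))
    (F := fun t x => J t x * eta β b (density ν x / J t x))
    (F' := fun t x => -pressure β b (density ν x / J t x) * J' t x) (x₀ := (0 : ℝ))
    (s := Metric.ball 0 δ) (bound := fun x => L * (2 * density ν x) * C)
    (Metric.ball_mem_nhds _ hδ) ?_ ?_ ?_ ?_ ?_ ?_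
  · have h2 := main.2.congr_of_eventuallyEq heq
    refine h2.congr_deriv ?_
    rw [← integral_neg]
    refine integral_congr_ae (ae_of_all _ fun x => ?_)
    simp [J, J', detOneAdd_zero, detOneAddDeriv_zero, divergence]
  · filter_upwards [Metric.ball_mem_nhds (0 : ℝ) hδ] with t ht
    exact ((hJm t).mul (h.measurable_eta_comp ((measurable_density ν).div (hJm t)) fun x =>
      div_nonneg (density_nonneg ν x) (hJpos (hball ht) x).le)).aestronglyMeasurable
  · simpa [J, detOneAdd_zero] using hint
  · exact ((h.continuous_pressure.measurable.comp
      ((measurable_density ν).div (hJm 0))).neg.mul (hJ'm 0)).aestronglyMeasurable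
  · refine ae_of_all _ fun x t ht => ?_
    obtain ⟨h1, h2, h3⟩ := (hδC t (hball ht)).2 x
    have hpos := hJpos (hball ht) x
    have hv := density_nonneg ν x
    rw [norm_mul, norm_neg]
    refine mul_le_mul ((abs_pressure_le hL _).trans ?_) h3 (norm_nonneg _) (by positivity)
    refine mul_le_mul_of_nonneg_left ?_ hL0
    rw [abs_of_nonneg (div_nonneg hv hpos.le), div_le_iff₀ hpos]
    nlinarith
  · exact (((integrable_density ν).const_mul 2).const_mul L).mul_const C
  · refine ae_of_all _ fun x t ht => ?_
    exact (h.hasDerivAt_perspective (density_nonneg ν x) (hJpos (hball ht) x)).comp t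
      (hasDerivAt_detOneAdd t (fderiv ℝ φ x))

/-- Written as `∫ Φ(x + t φ) dν`, the integral has an integrand whose `t`-derivative is bounded, and
`ν` is finite. -/
theorem Coefficients.hasDerivAt_integral_potential (h : Coefficients β b Φ) {ν : Measure (Rd d)}
    (hν : ν ∈ energyDomain Φ) {φ : Rd d → Rd d} (hφ : IsC1cField φ) :
    HasDerivAt (fun t => ∫ x, Φ x * density (pushCurve ν φ t) x)
      (∫ x, inner ℝ (∇ Φ x) (φ x) ∂ν) 0 := by
  have hmem := h.pushCurve_mem_energyDomain hν hφ
  obtain ⟨hp, hac, hΦ, hlog⟩ := hν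
  obtain ⟨M, hM0, hM, -⟩ := h.exists_lipschitz_bound
  obtain ⟨B, hB⟩ := hφ.1.continuous.bounded_above_of_compact_support hφ.2
  have hΦd := h.contDiff_Phi.differentiable one_ne_zero
  have hg := continuous_gradient_of_contDiff h.contDiff_Phi
  have heq : (fun t => ∫ x, Φ x * density (pushCurve ν φ t) x) =ᶠ[𝓝 0]
      fun t => ∫ x, Φ (x + t • φ x) ∂ν := by
    filter_upwards [hmem] with t ht
    have := ht.1
    simp_rw [mul_comm (Φ _)]
    rw [← integral_map (hφ.continuous_add_smul t).aemeasurable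
      h.contDiff_Phi.continuous.aestronglyMeasurable]
    exact integral_density_smul ht.2.1 Φ
  have main := hasDerivAt_integral_of_dominated_loc_of_deriv_le (μ := ν)
    (F := fun t x => Φ (x + t • φ x))
    (F' := fun t x => inner ℝ (∇ Φ (x + t • φ x)) (φ x)) (x₀ := (0 : ℝ))
    (s := Set.univ) (bound := fun _ => M * B) univ_mem ?_ ?_ ?_ ?_ ?_ ?_
  · simpa using main.2.congr_of_eventuallyEq heq
  · exact Eventually.of_forall fun t =>
      (h.contDiff_Phi.continuous.comp (hφ.continuous_add_smul t)).aestronglyMeasurable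
  · exact h.integrable_comp_add_smul hΦ hφ 0
  · exact ((hg.comp (hφ.continuous_add_smul 0)).inner hφ.1.continuous).aestronglyMeasurable
  · refine ae_of_all _ fun x t _ => (norm_inner_le_norm _ _).trans ?_
    exact mul_le_mul (hM _) (hB x) (norm_nonneg _) hM0
  · exact integrable_const _
  · refine ae_of_all _ fun x t _ => ?_
    rw [inner_gradient_left]
    have h1 : HasDerivAt (fun t : ℝ => x + t • φ x) (φ x) t := by
      simpa using ((hasDerivAt_id t).smul_const (φ x)).const_add x
    exact (hΦd _).hasFDerivAt.comp_hasDerivAt t h1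

theorem Coefficients.hasDerivAt_energy (h : Coefficients β b Φ) {ν : Measure (Rd d)}
    (hν : ν ∈ energyDomain Φ) {φ : Rd d → Rd d} (hφ : IsC1cField φ) :
    HasDerivAt (fun t => energy β b Φ (pushCurve ν φ t))
      (-(∫ x, pressure β b (density ν x) * divergence φ x) + ∫ x, inner ℝ (∇ Φ x) (φ x) ∂ν) 0 :=
  (h.hasDerivAt_integral_eta hν hφ).add (h.hasDerivAt_integral_potential hν hφ)

end EnergyDerivative

/-! ### Fields in the `L²(ν)`-closure of gradients of test functions. -/

section GradientLimits

/-- `U` is an `L²(ν)`-limit of gradients of test functions. -/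
def IsGradientLimit (ν : Measure (Rd d)) (U : Rd d → Rd d) : Prop :=
  ∀ ε : ℝ≥0∞, 0 < ε → ∃ ζ : Rd d → ℝ, IsTestFunction ζ ∧ eLpNorm (∇ ζ - U) 2 ν ≤ ε

theorem IsGradientLimit.of_tendsto {ν : Measure (Rd d)} {V : ℕ → Rd d → Rd d} {U : Rd d → Rd d}
    (hV : ∀ n, IsGradientLimit ν (V n)) (hVm : ∀ n, AEStronglyMeasurable (V n) ν)
    (hU : AEStronglyMeasurable U ν)
    (h : Tendsto (fun n => eLpNorm (V n - U) 2 ν) atTop (𝓝 0)) : IsGradientLimit ν U := by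
  intro ε hε
  have hε2 : 0 < ε / 2 := ENNReal.half_pos hε.ne'
  obtain ⟨n, hn⟩ := (ENNReal.tendsto_nhds_zero.1 h _ hε2).exists
  obtain ⟨ζ, hζ, hζn⟩ := hV n _ hε2
  refine ⟨ζ, hζ, ?_⟩
  rw [← sub_add_sub_cancel (∇ ζ) (V n) U, ← ENNReal.add_halves ε]
  exact (eLpNorm_add_le (hζ.continuous_gradient.aestronglyMeasurable.sub (hVm n))
    ((hVm n).sub hU) one_le_two).trans (add_le_add hζn hn)

theorem IsGradientLimit.add {ν : Measure (Rd d)} {U V : Rd d → Rd d} (hU : IsGradientLimit ν U)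
    (hV : IsGradientLimit ν V) (hUm : AEStronglyMeasurable U ν) (hVm : AEStronglyMeasurable V ν) :
    IsGradientLimit ν (U + V) := by
  intro ε hε
  have hε2 : 0 < ε / 2 := ENNReal.half_pos hε.ne'
  obtain ⟨ζ, hζ, hζn⟩ := hU _ hε2
  obtain ⟨ξ, hξ, hξn⟩ := hV _ hε2
  refine ⟨fun x => ζ x + ξ x, ⟨hζ.1.add hξ.1, hζ.2.add hξ.2⟩, ?_⟩
  have he : ∇ (fun x => ζ x + ξ x) - (U + V) = (∇ ζ - U) + (∇ ξ - V) := by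
    funext x
    have : ∇ (fun x => ζ x + ξ x) x = ∇ ζ x + ∇ ξ x := by
      unfold gradient
      rw [fderiv_fun_add (hζ.contDiff_one.differentiable one_ne_zero x)
        (hξ.contDiff_one.differentiable one_ne_zero x), map_add]
    simp only [Pi.sub_apply, Pi.add_apply, this]
    abel
  rw [he, ← ENNReal.add_halves ε]
  exact (eLpNorm_add_le (hζ.continuous_gradient.aestronglyMeasurable.sub hUm)
    (hξ.continuous_gradient.aestronglyMeasurable.sub hVm) one_le_two).trans (add_le_add hζn hξn)

theorem measure_le_smul_volume {ν : Measure (Rd d)} [IsFiniteMeasure ν] (hν : ν ≪ volume) {M : ℝ}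
    (hM : ∀ᵐ x, density ν x ≤ M) : ν ≤ ENNReal.ofReal M • (volume : Measure (Rd d)) := by
  conv_lhs => rw [← Measure.withDensity_rnDeriv_eq ν volume hν]
  rw [← withDensity_const]
  refine withDensity_mono ?_
  filter_upwards [hM, Measure.rnDeriv_lt_top ν volume] with x hx hlt
  rw [← ENNReal.ofReal_toReal hlt.ne]
  exact ENNReal.ofReal_le_ofReal hx

/-- This is where a bounded density pays off: approximation may be done in `L²(dx)`. -/
theorem tendsto_eLpNorm_of_le_smul {ν : Measure (Rd d)} {c : ℝ≥0∞} (hc : c ≠ ⊤)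
    (hν : ν ≤ c • (volume : Measure (Rd d))) {u : ℕ → Rd d → Rd d}
    (h : Tendsto (fun n => eLpNorm (u n) 2 volume) atTop (𝓝 0)) :
    Tendsto (fun n => eLpNorm (u n) 2 ν) atTop (𝓝 0) := by
  have h1 : Tendsto (fun n => c ^ (1 / (2 : ℝ≥0∞)).toReal * eLpNorm (u n) 2 volume) atTop
      (𝓝 0) := by
    simpa using ENNReal.Tendsto.const_mul h (Or.inr (ENNReal.rpow_ne_top_of_nonneg (by simp) hc))
  refine tendsto_of_tendsto_of_tendsto_of_le_of_le tendsto_const_nhds h1 (fun _ => zero_le)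
    fun n => ?_
  refine (eLpNorm_mono_measure _ hν).trans ?_
  rw [eLpNorm_smul_measure_of_ne_top (by simp)]
  simp

theorem isGradientLimit_gradient {ν : Measure (Rd d)} {c : ℝ≥0∞} (hc : c ≠ ⊤)
    (hν : ν ≤ c • (volume : Measure (Rd d))) {f : Rd d → ℝ} (hf : ContDiff ℝ 1 f)
    (hfc : HasCompactSupport f) : IsGradientLimit ν (∇ f) := by
  have hg := continuous_gradient_of_contDiff hf
  obtain ⟨ζ, hζ, -, -, h⟩ := (hasWeakGradient_of_contDiff hf).exists_seq_testFunction one_le_two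
    ENNReal.ofNat_ne_top (hf.continuous.memLp_of_hasCompactSupport hfc)
    (hg.memLp_of_hasCompactSupport (hasCompactSupport_gradient hfc))
  intro ε hε
  obtain ⟨n, hn⟩ := (ENNReal.tendsto_nhds_zero.1 (tendsto_eLpNorm_of_le_smul hc hν h) _ hε).exists
  exact ⟨ζ n, hζ n, hn⟩

/-- Cut off: `∇(χ_n Φ) = χ_n ∇Φ + Φ ∇χ_n`. The last term tends to `0` pointwise and stays bounded,
because `Φ` grows at most linearly and `|x| |∇χ_n|` is bounded. A constant dominates, as `ν` is
finite. -/
theorem Coefficients.isGradientLimit_potential {β b : ℝ → ℝ} {Φ : Rd d → ℝ}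
    (h : Coefficients β b Φ) {ν : Measure (Rd d)} [IsFiniteMeasure ν] {c : ℝ≥0∞} (hc : c ≠ ⊤)
    (hν : ν ≤ c • (volume : Measure (Rd d))) : IsGradientLimit ν (∇ Φ) := by
  obtain ⟨M, hM0, hM, hlip⟩ := h.exists_lipschitz_bound
  obtain ⟨χ, C, hC, hχ, hχb, hχ1, hχg, hχx⟩ := exists_seq_cutoff d
  have hg := continuous_gradient_of_contDiff h.contDiff_Phi
  have hcd : ∀ n, ContDiff ℝ 1 fun x => χ n x * Φ x := fun n =>
    (hχ n).contDiff_one.mul h.contDiff_Phi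
  have hgrad : ∀ n x, ∇ (fun x => χ n x * Φ x) x = χ n x • ∇ Φ x + Φ x • ∇ (χ n) x := fun n x =>
    gradient_mul ((hχ n).contDiff_one.differentiable one_ne_zero x)
      (h.contDiff_Phi.differentiable one_ne_zero x)
  refine IsGradientLimit.of_tendsto (V := fun n => ∇ fun x => χ n x * Φ x)
    (fun n => isGradientLimit_gradient hc hν (hcd n) (hχ n).2.mul_right)
    (fun n => (continuous_gradient_of_contDiff (hcd n)).aestronglyMeasurable)
    hg.aestronglyMeasurable ?_
  have hgC : ∀ n x, ‖∇ (χ n) x‖ ≤ C := fun n x => (hχg n x).trans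
    (div_le_self hC (by linarith [show (0 : ℝ) ≤ n from n.cast_nonneg]))
  refine tendsto_eLpNorm_zero_of_dominated two_ne_zero ENNReal.ofNat_ne_top
    (G := fun _ => M + (|Φ 0| * C + M * C))
    (fun n => ((continuous_gradient_of_contDiff (hcd n)).sub hg).aestronglyMeasurable)
    (memLp_const _) (fun n => ae_of_all _ fun x => ?_) (ae_of_all _ fun x => ?_)
  · have : ∇ (fun x => χ n x * Φ x) x - ∇ Φ x = (χ n x - 1) • ∇ Φ x + Φ x • ∇ (χ n) x := by
      rw [hgrad, sub_smul, one_smul]; abel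
    rw [Pi.sub_apply, this]
    refine (norm_add_le _ _).trans (add_le_add ?_ ?_)
    · rw [norm_smul]
      refine (mul_le_of_le_one_left (norm_nonneg _) ?_).trans (hM x)
      rw [Real.norm_eq_abs, abs_le]
      constructor <;> linarith [(hχb n x).1, (hχb n x).2]
    · rw [norm_smul]
      have h1 : ‖Φ x‖ ≤ |Φ 0| + M * ‖x‖ := by
        have h2 := hlip x 0
        rw [sub_zero] at h2
        have h3 := norm_sub_norm_le (Φ x) (Φ 0)
        rw [Real.norm_eq_abs (Φ 0)] at h3
        linarith
      calc ‖Φ x‖ * ‖∇ (χ n) x‖ ≤ (|Φ 0| + M * ‖x‖) * ‖∇ (χ n) x‖ := by gcongr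
        _ = |Φ 0| * ‖∇ (χ n) x‖ + M * (‖x‖ * ‖∇ (χ n) x‖) := by ring
        _ ≤ |Φ 0| * C + M * C := by
          gcongr
          · exact hgC n x
          · exact hχx n x
  · have l1 : Tendsto (fun n => ∇ (χ n) x) atTop (𝓝 0) := by
      refine squeeze_zero_norm (fun n => hχg n x) ?_
      exact tendsto_const_div_atTop_nhds_zero_nat C |>.comp (tendsto_add_atTop_nat 1) |>.congr
        fun n => by simp
    have l2 : Tendsto (fun n => Φ x • ∇ (χ n) x) atTop (𝓝 0) := by
      simpa using l1.const_smul (Φ x)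
    refine l2.congr' ?_
    filter_upwards [hχ1 x] with n hn
    rw [Pi.sub_apply, hgrad, hn]
    simp

/-- Weak gradients of `C^1` functions of an `H^1` function are limits of gradients. -/
theorem HasWeakGradient.isGradientLimit_comp {ν : Measure (Rd d)} {c : ℝ≥0∞} (hc : c ≠ ⊤)
    (hν : ν ≤ c • (volume : Measure (Rd d))) (hac : ν ≪ volume) {v : Rd d → ℝ}
    {Dv : Rd d → Rd d} (h : HasWeakGradient v Dv) (hv : MemLp v 2 volume)
    (hDv : MemLp Dv 2 volume) {k : ℝ → ℝ} {L : ℝ} (hk : Continuous k) (hL : ∀ s, |k s| ≤ L) :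
    IsGradientLimit ν fun x => k (v x) • Dv x := by
  have hL0 : 0 ≤ L := (abs_nonneg _).trans (hL 0)
  obtain ⟨ζ, hζ, hae, -, ht⟩ := h.exists_seq_testFunction one_le_two ENNReal.ofNat_ne_top hv hDv
  -- The antiderivative vanishing at `0` is chosen so that `K ∘ ζ n` has compact support.
  let K : ℝ → ℝ := fun s => ∫ w in (0 : ℝ)..s, k w
  have hK : ∀ s, HasDerivAt K (k s) s := fun s =>
    intervalIntegral.integral_hasDerivAt_right (hk.intervalIntegrable _ _)
      hk.stronglyMeasurable.stronglyMeasurableAtFilter hk.continuousAt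
  have hgrad : ∀ n x, ∇ (fun y => K (ζ n y)) x = k (ζ n x) • ∇ (ζ n) x := fun n x =>
    gradient_comp_of_hasDerivAt (hK _) ((hζ n).contDiff_one.differentiable one_ne_zero x)
  have hcont : ∀ n, Continuous fun x => k (ζ n x) • ∇ (ζ n) x := fun n =>
    (hk.comp (hζ n).1.continuous).smul (hζ n).continuous_gradient
  have hcm : ∀ n, AEStronglyMeasurable (fun x => k (ζ n x) • (∇ (ζ n) x - Dv x)) volume :=
    fun n => (hk.comp (hζ n).1.continuous).aestronglyMeasurable.smul
      ((hζ n).continuous_gradient.aestronglyMeasurable.sub hDv.1)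
  have hcm' : ∀ n, AEStronglyMeasurable (fun x => (k (ζ n x) - k (v x)) • Dv x) volume :=
    fun n => ((hk.comp (hζ n).1.continuous).aestronglyMeasurable.sub
      (hk.comp_aestronglyMeasurable hv.1)).smul hDv.1
  refine IsGradientLimit.of_tendsto (V := fun n x => k (ζ n x) • ∇ (ζ n) x) (fun n => ?_)
    (fun n => (hcont n).aestronglyMeasurable)
    (((hk.comp_aestronglyMeasurable hv.1).smul hDv.1).mono_ac hac) ?_
  · rw [← funext (hgrad n)]
    exact isGradientLimit_gradient hc hν ((contDiff_one_of_hasDerivAt hK hk).comp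
      (hζ n).contDiff_one) ((hζ n).2.comp_left (g := K) (by simp [K]))
  · refine tendsto_eLpNorm_of_le_smul hc hν ?_
    -- The error splits into `k (ζ n) • (∇ (ζ n) - Dv)`, small since `k` is bounded, and `(k (ζ n) -
    -- k v) • Dv`, small by domination.
    have t1 : Tendsto (fun n => eLpNorm (fun x => k (ζ n x) • (∇ (ζ n) x - Dv x)) 2 volume) atTop
        (𝓝 0) := by
      have h1 : Tendsto (fun n => ENNReal.ofReal L * eLpNorm (∇ (ζ n) - Dv) 2 volume) atTop
          (𝓝 0) := by
        simpa using ENNReal.Tendsto.const_mul ht (Or.inr ENNReal.ofReal_ne_top)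
      refine tendsto_of_tendsto_of_tendsto_of_le_of_le tendsto_const_nhds h1 (fun _ => zero_le)
        fun n => ?_
      refine eLpNorm_le_mul_eLpNorm_of_ae_le_mul (ae_of_all _ fun x => ?_) _
      rw [norm_smul]
      exact mul_le_mul_of_nonneg_right (hL _) (norm_nonneg _)
    have t2 : Tendsto (fun n => eLpNorm (fun x => (k (ζ n x) - k (v x)) • Dv x) 2 volume) atTop
        (𝓝 0) := by
      refine tendsto_eLpNorm_zero_of_dominated two_ne_zero ENNReal.ofNat_ne_top
        (G := fun x => 2 * L * ‖Dv x‖) hcm' (hDv.norm.const_mul _)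
        (fun n => ae_of_all _ fun x => ?_) ?_
      · rw [norm_smul]
        refine mul_le_mul_of_nonneg_right ?_ (norm_nonneg _)
        refine (norm_sub_le _ _).trans ?_
        rw [two_mul]
        exact add_le_add (hL _) (hL _)
      · filter_upwards [hae] with x hx
        have := (((hk.tendsto _).comp hx).sub_const (k (v x))).smul_const (Dv x)
        simpa using this
    have t3 := t1.add t2
    rw [add_zero] at t3
    refine tendsto_of_tendsto_of_tendsto_of_le_of_le tendsto_const_nhds t3 (fun _ => zero_le)
      fun n => ?_
    refine le_trans (le_of_eq ?_) (eLpNorm_add_le (hcm n) (hcm' n) one_le_two)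
    congr 1
    funext x
    simp only [Pi.sub_apply, Pi.add_apply, smul_sub, sub_smul]
    abel

/-- The logarithmic gradient `k(v) ∇v / v` is a limit of gradients. -/
theorem HasWeakGradient.isGradientLimit_log {ν : Measure (Rd d)} {c : ℝ≥0∞} (hc : c ≠ ⊤)
    (hν : ν ≤ c • (volume : Measure (Rd d))) (hac : ν ≪ volume) {v : Rd d → ℝ}
    {Dv : Rd d → Rd d} (h : HasWeakGradient v Dv) (hv0 : ∀ x, 0 ≤ v x) (hv : MemLp v 2 volume)
    (hDv : MemLp Dv 2 volume) (hlog : MemLp (fun x => (v x)⁻¹ • Dv x) 2 ν)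
    {k : ℝ → ℝ} {L : ℝ} (hk : Continuous k) (hL : ∀ s, |k s| ≤ L) :
    IsGradientLimit ν fun x => k (v x) • (v x)⁻¹ • Dv x := by
  have hL0 : 0 ≤ L := (abs_nonneg _).trans (hL 0)
  have hpos : ∀ n : ℕ, (0 : ℝ) < 1 / ((n : ℝ) + 1) := fun n => by positivity
  have hpos' : ∀ (n : ℕ) (s : ℝ), (0 : ℝ) < |s| + 1 / ((n : ℝ) + 1) := fun n s => by positivity
  -- Regularizing `1/|s|` makes the factor continuous and bounded for each `n`, while keeping it at
  -- most `L/|s|`, so that `2 L |∇v/v|` dominates the error.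
  let κ : ℕ → ℝ → ℝ := fun n s => k s / (|s| + 1 / ((n : ℝ) + 1))
  have hκ : ∀ n, Continuous (κ n) := fun n =>
    hk.div (continuous_abs.add continuous_const) fun s => (hpos' n s).ne'
  have hκL : ∀ n s, |κ n s| ≤ L / (1 / ((n : ℝ) + 1)) := fun n s => by
    rw [abs_div, abs_of_pos (hpos' n s)]
    exact div_le_div₀ hL0 (hL s) (hpos n) (by linarith [abs_nonneg s])
  have hvm : AEStronglyMeasurable v ν := hv.1.mono_ac hac
  have hDm : AEStronglyMeasurable Dv ν := hDv.1.mono_ac hac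
  have hUm : AEStronglyMeasurable (fun x => k (v x) • (v x)⁻¹ • Dv x) ν :=
    (hk.comp_aestronglyMeasurable hvm).smul hlog.1
  have hVm : ∀ n, AEStronglyMeasurable (fun x => κ n (v x) • Dv x) ν := fun n =>
    ((hκ n).comp_aestronglyMeasurable hvm).smul hDm
  have hzero : ∀ᵐ x ∂ν, v x = 0 → Dv x = 0 := hac.ae_le h.ae_eq_zero_of_eq_zero
  refine IsGradientLimit.of_tendsto (V := fun n x => κ n (v x) • Dv x)
    (fun n => h.isGradientLimit_comp hc hν hac hv hDv (hκ n) (hκL n)) hVm hUm ?_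
  refine tendsto_eLpNorm_zero_of_dominated two_ne_zero ENNReal.ofNat_ne_top
    (G := fun x => 2 * L * ‖(v x)⁻¹ • Dv x‖) (fun n => (hVm n).sub hUm)
    (hlog.norm.const_mul _) (fun n => ?_) ?_
  · filter_upwards [hzero] with x hx
    rcases (hv0 x).eq_or_lt with h0 | h0
    · simp [hx h0.symm]
    · rw [Pi.sub_apply]
      refine (norm_sub_le _ _).trans ?_
      rw [mul_assoc, two_mul]
      refine add_le_add ?_ ?_
      · rw [norm_smul, norm_smul, ← mul_assoc]
        refine mul_le_mul_of_nonneg_right ?_ (norm_nonneg _)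
        rw [Real.norm_eq_abs, Real.norm_eq_abs, abs_div, abs_of_pos (hpos' n _), abs_inv,
          ← div_eq_mul_inv]
        exact div_le_div₀ hL0 (hL _) (abs_pos.2 h0.ne') (by linarith [hpos n])
      · rw [norm_smul (k (v x))]
        exact mul_le_mul_of_nonneg_right (hL _) (norm_nonneg _)
  · filter_upwards [hzero] with x hx
    rcases (hv0 x).eq_or_lt with h0 | h0
    · simp [hx h0.symm]
    · have h1 : Tendsto (fun n => κ n (v x)) atTop (𝓝 (k (v x) / (|v x| + 0))) :=
        tendsto_const_nhds.div (tendsto_const_nhds.add tendsto_one_div_add_atTop_nhds_zero_nat)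
          (by simpa using h0.ne')
      rw [add_zero, abs_of_pos h0] at h1
      have h2 := (h1.smul_const (Dv x)).sub_const (k (v x) • (v x)⁻¹ • Dv x)
      rw [smul_smul, ← div_eq_mul_inv, sub_self] at h2
      simpa only [Pi.sub_apply, smul_smul, div_eq_mul_inv] using h2

end GradientLimits

/-! ### Existence, uniqueness and location of the weighted gradient. -/

section WeightedGradient

variable {β b : ℝ → ℝ} {Φ : Rd d → ℝ} {ν : Measure (Rd d)}

theorem integrable_density_smul_iff [IsFiniteMeasure ν] (hν : ν ≪ volume) {f : Rd d → ℝ} :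
    Integrable (fun x => density ν x * f x) volume ↔ Integrable f ν :=
  integrable_rnDeriv_smul_iff hν

theorem exists_density_bound (h : MemLp (density ν) ⊤ volume) :
    ∃ M : ℝ, ∀ᵐ x, density ν x ≤ M := by
  have hb := ae_le_eLpNormEssSup (f := density ν) (μ := volume)
  refine ⟨(eLpNorm (density ν) ⊤ volume).toReal, ?_⟩
  filter_upwards [hb] with x hx
  rw [← eLpNorm_exponent_top] at hx
  have := ENNReal.toReal_mono h.2.ne hx
  simp only [toReal_enorm] at this
  exact (le_abs_self _).trans this

theorem memLp_two_density [IsFiniteMeasure ν] {M : ℝ} (hM : ∀ᵐ x, density ν x ≤ M) :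
    MemLp (density ν) 2 volume := by
  rw [memLp_two_iff_integrable_sq (measurable_density ν).aestronglyMeasurable]
  refine ((integrable_density ν).const_mul M).mono'
    ((measurable_density ν).pow_const 2).aestronglyMeasurable ?_
  filter_upwards [hM] with x hx
  rw [Real.norm_of_nonneg (sq_nonneg _), sq]
  exact mul_le_mul_of_nonneg_right hx (density_nonneg ν x)

/-- `|Dv|² = v · v |Dv/v|² ≤ M v |Dv/v|²`, valid also on `{v = 0}`, where `Dv` vanishes almost
everywhere. -/
theorem HasWeakGradient.memLp_two_grad [IsFiniteMeasure ν] (hac : ν ≪ volume) {M : ℝ}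
    (hM : ∀ᵐ x, density ν x ≤ M) {Dv : Rd d → Rd d} (h : HasWeakGradient (density ν) Dv)
    (hlog : MemLp (fun x => (density ν x)⁻¹ • Dv x) 2 ν) : MemLp Dv 2 volume := by
  have hDm := h.locallyIntegrable_grad.aestronglyMeasurable
  rw [memLp_two_iff_integrable_sq_norm hDm]
  have h1 := (integrable_density_smul_iff hac).2 ((memLp_two_iff_integrable_sq_norm hlog.1).1 hlog)
  refine (h1.const_mul M).mono' (hDm.norm.pow 2) ?_
  filter_upwards [hM, h.ae_eq_zero_of_eq_zero] with x hx h0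
  rw [Real.norm_of_nonneg (sq_nonneg _)]
  rcases (density_nonneg ν x).eq_or_lt with hz | hz
  · simp [h0 hz.symm, ← hz]
  · rw [norm_smul, norm_inv, Real.norm_of_nonneg hz.le, mul_pow]
    have : density ν x * ((density ν x)⁻¹ ^ 2 * ‖Dv x‖ ^ 2) = ‖Dv x‖ ^ 2 / density ν x := by
      field_simp
    rw [this, mul_div_assoc', le_div_iff₀ hz, mul_comm]
    exact mul_le_mul_of_nonneg_right hx (sq_nonneg _)

/-- The gradient `∇(g(v) + Φ) = β'(v) / b(v) ∇v / v + ∇Φ`. -/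
def chemicalGradient (β b : ℝ → ℝ) (Φ : Rd d → ℝ) (ν : Measure (Rd d)) (Dv : Rd d → Rd d)
    (x : Rd d) : Rd d :=
  (deriv β (density ν x) / b (density ν x)) • (density ν x)⁻¹ • Dv x + ∇ Φ x

theorem Coefficients.memLp_diffusion (h : Coefficients β b Φ) {Dv : Rd d → Rd d}
    (hlog : MemLp (fun x => (density ν x)⁻¹ • Dv x) 2 ν) :
    MemLp (fun x => (deriv β (density ν x) / b (density ν x)) • (density ν x)⁻¹ • Dv x) 2 ν := by
  obtain ⟨L, hL0, hL⟩ := h.exists_ratio_bound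
  refine hlog.of_le_mul (c := L) ?_ (ae_of_all _ fun x => ?_)
  · exact (h.continuous_ratio.measurable.comp
      (measurable_density ν)).aestronglyMeasurable.smul hlog.1
  · rw [norm_smul]
    exact mul_le_mul_of_nonneg_right (hL _) (norm_nonneg _)

theorem Coefficients.memLp_gradient (h : Coefficients β b Φ) [IsFiniteMeasure ν] :
    MemLp (∇ Φ) 2 ν := by
  obtain ⟨M, -, hM, -⟩ := h.exists_lipschitz_bound
  exact MemLp.of_bound (continuous_gradient_of_contDiff h.contDiff_Phi).aestronglyMeasurable M
    (ae_of_all _ hM)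

theorem Coefficients.memLp_chemicalGradient (h : Coefficients β b Φ) [IsFiniteMeasure ν]
    {Dv : Rd d → Rd d} (hlog : MemLp (fun x => (density ν x)⁻¹ • Dv x) 2 ν) :
    MemLp (chemicalGradient β b Φ ν Dv) 2 ν :=
  (h.memLp_diffusion hlog).add h.memLp_gradient

theorem IsC1cField.memLp [IsFiniteMeasure ν] {φ : Rd d → Rd d} (hφ : IsC1cField φ) :
    MemLp φ 2 ν := hφ.1.continuous.memLp_of_hasCompactSupport hφ.2

theorem integrable_inner_of_memLp {u w : Rd d → Rd d} (hu : MemLp u 2 ν) (hw : MemLp w 2 ν) :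
    Integrable (fun x => inner ℝ (u x) (w x)) ν := by
  have := L2.integrable_inner (𝕜 := ℝ) (hu.toLp u) (hw.toLp w)
  refine this.congr ?_
  filter_upwards [hu.coeFn_toLp, hw.coeFn_toLp] with x h1 h2
  rw [h1, h2]

theorem abs_integral_inner_le {u w : Rd d → Rd d} (hu : MemLp u 2 ν) (hw : MemLp w 2 ν) :
    |∫ x, inner ℝ (u x) (w x) ∂ν| ≤ (eLpNorm u 2 ν).toReal * (eLpNorm w 2 ν).toReal := by
  have h1 : ∫ x, inner ℝ (u x) (w x) ∂ν = inner ℝ (hu.toLp u) (hw.toLp w) := by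
    rw [L2.inner_def]
    refine integral_congr_ae ?_
    filter_upwards [hu.coeFn_toLp, hw.coeFn_toLp] with x h1 h2
    rw [h1, h2]
  rw [h1, ← Lp.norm_toLp u hu, ← Lp.norm_toLp w hw]
  exact abs_real_inner_le_norm _ _

theorem Coefficients.hasDerivAt_energy_chemicalGradient (h : Coefficients β b Φ)
    (hν : ν ∈ energyDomain Φ) {Dv : Rd d → Rd d} (hD : HasWeakGradient (density ν) Dv)
    (hlog : MemLp (fun x => (density ν x)⁻¹ • Dv x) 2 ν) {φ : Rd d → Rd d}
    (hφ : IsC1cField φ) :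
    HasDerivAt (fun t => energy β b Φ (pushCurve ν φ t))
      (∫ x, inner ℝ (chemicalGradient β b Φ ν Dv x) (φ x) ∂ν) 0 := by
  have hE := h.hasDerivAt_energy hν hφ
  obtain ⟨hp, hac, -, -⟩ := hν
  obtain ⟨L, -, hL⟩ := h.exists_ratio_bound
  refine hE.congr_deriv ?_
  simp_rw [chemicalGradient, inner_add_left]
  rw [integral_add (integrable_inner_of_memLp (h.memLp_diffusion hlog) hφ.memLp)
    (integrable_inner_of_memLp h.memLp_gradient hφ.memLp),
    hD.integral_comp_mul_divergence h.hasDerivAt_pressure h.continuous_ratio hL hφ, neg_neg,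
    ← integral_density_smul hac fun x => inner ℝ ((deriv β (density ν x) / b (density ν x)) •
      (density ν x)⁻¹ • Dv x) (φ x)]
  congr 1
  refine integral_congr_ae ?_
  -- With `0⁻¹ = 0`, the identity `v • v⁻¹ • Dv = Dv` on `{v = 0}` requires `Dv = 0` there.
  filter_upwards [hD.ae_eq_zero_of_eq_zero] with x hx
  by_cases h0 : density ν x = 0
  · simp [hx h0]
  · simp only [real_inner_smul_left, smul_eq_mul]
    field_simp

theorem Coefficients.memDiffDomain (h : Coefficients β b Φ) (hν : ν ∈ domainD0 Φ) :
    MemDiffDomain (energyDomain Φ) (energy β b Φ) ν := by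
  obtain ⟨⟨hp, hac, hb, Dv, hD, hlog⟩, hE⟩ := hν
  have hder := fun φ hφ => h.hasDerivAt_energy_chemicalGradient hE hD hlog (φ := φ) hφ
  have hW := h.memLp_chemicalGradient hlog
  have hval : ∀ φ, IsC1cField φ → diffAt (energy β b Φ) ν φ =
      ∫ x, inner ℝ (chemicalGradient β b Φ ν Dv x) (φ x) ∂ν := fun φ hφ => (hder φ hφ).deriv
  refine ⟨hE, fun φ hφ => h.pushCurve_mem_energyDomain hE hφ,
    fun φ hφ => (hder φ hφ).differentiableAt, fun φ ψ hφ hψ => ?_, fun c φ hφ => ?_,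
    ⟨(eLpNorm (chemicalGradient β b Φ ν Dv) 2 ν).toReal, fun φ hφ => ?_⟩⟩
  · rw [hval _ hφ, hval _ hψ, hval _ ⟨hφ.1.add hψ.1, hφ.2.add hψ.2⟩,
      ← integral_add (integrable_inner_of_memLp hW hφ.memLp)
        (integrable_inner_of_memLp hW hψ.memLp)]
    simp_rw [inner_add_right]
  · rw [hval _ hφ, hval _ ⟨hφ.1.const_smul c, hφ.2.smul_left (f := fun _ => c)⟩,
      ← integral_const_mul]
    simp_rw [inner_smul_right]
  · rw [hval _ hφ]
    exact abs_integral_inner_le hW hφ.memLp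

theorem Coefficients.memLp_b_smul (h : Coefficients β b Φ) {U : Rd d → Rd d}
    (hU : MemLp U 2 ν) : MemLp (fun x => b (density ν x) • U x) 2 ν := by
  obtain ⟨B, hB⟩ := h.b_bounded
  refine hU.of_le_mul (c := B) ((h.contDiff_b.continuous.measurable.comp
    (measurable_density ν)).aestronglyMeasurable.smul hU.1) (ae_of_all _ fun x => ?_)
  rw [norm_smul]
  exact mul_le_mul_of_nonneg_right (hB _) (norm_nonneg _)

theorem Coefficients.isWeightedGradient_toLp (h : Coefficients β b Φ) (hE : ν ∈ energyDomain Φ)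
    {Dv : Rd d → Rd d} (hD : HasWeakGradient (density ν) Dv)
    (hlog : MemLp (fun x => (density ν x)⁻¹ • Dv x) 2 ν)
    (hW : MemLp (fun x => b (density ν x) • chemicalGradient β b Φ ν Dv x) 2 ν) :
    IsWeightedGradient (energy β b Φ) (weight b) ν (hW.toLp _) := by
  intro φ hφ
  rw [diffAt, (h.hasDerivAt_energy_chemicalGradient hE hD hlog hφ).deriv, weight, if_pos hE.2.1]
  refine integral_congr_ae ?_
  filter_upwards [hW.coeFn_toLp] with x hx
  rw [hx, real_inner_smul_left, ← mul_assoc, one_div, inv_mul_cancel₀ (h.b_pos _).ne', one_mul]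

/-- A weighted gradient is unique. -/
theorem Coefficients.isWeightedGradient_unique (h : Coefficients β b Φ) [IsFiniteMeasure ν]
    (hac : ν ≪ volume) {E : Measure (Rd d) → ℝ} {w w' : Lp (Rd d) 2 ν}
    (hw : IsWeightedGradient E (weight b) ν w) (hw' : IsWeightedGradient E (weight b) ν w') :
    w = w' := by
  obtain ⟨b₀, hb₀, hb⟩ := h.b_lower
  have hinv : ∀ u : Lp (Rd d) 2 ν, MemLp (fun x => (1 / b (density ν x)) • u x) 2 ν := by
    intro u
    refine (Lp.memLp u).of_le_mul (c := 1 / b₀) ?_ (ae_of_all _ fun x => ?_)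
    · exact ((h.contDiff_b.continuous.measurable.comp
        (measurable_density ν)).const_div 1).aestronglyMeasurable.smul (Lp.memLp u).1
    · rw [norm_smul, Real.norm_of_nonneg (one_div_nonneg.2 (h.b_pos _).le)]
      exact mul_le_mul_of_nonneg_right (one_div_le_one_div_of_le hb₀ (hb _)) (norm_nonneg _)
  have hloc : ∀ u : Lp (Rd d) 2 ν,
      LocallyIntegrable (fun x => (1 / b (density ν x)) • u x) ν := fun u =>
    ((hinv u).integrable one_le_two).locallyIntegrable
  -- Testing with fields `ζ e` identifies the integrals of `ζ w / b(v)` and `ζ w' / b(v)` in every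
  -- direction `e`; the positive factor `1 / b(v)` is then cancelled.
  have key := ae_eq_of_integral_contDiff_smul_eq (hloc w) (hloc w') fun ζ hζ hc => by
    have hζt : IsTestFunction ζ := ⟨hζ, hc⟩
    have hi : ∀ u : Lp (Rd d) 2 ν,
        Integrable (fun x => ζ x • (1 / b (density ν x)) • u x) ν := fun u =>
      (hloc u).integrable_smul_left_of_hasCompactSupport hζ.continuous hc
    refine ext_inner_left ℝ fun e => ?_
    rw [← integral_inner (hi w), ← integral_inner (hi w')]
    have h1 := hw _ (hζt.isC1cField_smul e)
    have h2 := hw' _ (hζt.isC1cField_smul e)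
    rw [weight, if_pos hac] at h1 h2
    have hform : ∀ (u : Lp (Rd d) 2 ν) x, inner ℝ e (ζ x • (1 / b (density ν x)) • u x) =
        1 / b (density ν x) * inner ℝ (u x) (ζ x • e) := fun u x => by
      rw [inner_smul_right, inner_smul_right, inner_smul_right, real_inner_comm]
      ring
    simp_rw [hform]
    exact h1.symm.trans h2
  refine Lp.ext ?_
  filter_upwards [key] with x hx
  exact smul_right_injective _ (one_div_ne_zero (h.b_pos (density ν x)).ne') hx

/-- Multiplication by `b(v)` is bounded on `L²(ν)`, so it carries approximations by `∇ζ` to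
approximations by `b(v) ∇ζ`. -/
theorem Coefficients.toLp_mem_weightedGradientFields (h : Coefficients β b Φ) [IsFiniteMeasure ν]
    {U : Rd d → Rd d} (hU : IsGradientLimit ν U)
    (hW : MemLp (fun x => b (density ν x) • U x) 2 ν) :
    hW.toLp _ ∈ weightedGradientFields b ν := by
  obtain ⟨B, hB⟩ := h.b_bounded
  refine EMetric.mem_closure_iff.2 fun ε hε => ?_
  obtain ⟨δ, hδ, hδε⟩ : ∃ δ : ℝ≥0∞, 0 < δ ∧ ENNReal.ofReal B * δ < ε := by
    have ht : Tendsto (fun n : ℕ => ENNReal.ofReal B * (n : ℝ≥0∞)⁻¹) atTop (𝓝 0) := by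
      simpa using ENNReal.Tendsto.const_mul ENNReal.tendsto_inv_nat_nhds_zero
        (Or.inr (ENNReal.ofReal_ne_top (r := B)))
    obtain ⟨n, hn⟩ := (ht.eventually (gt_mem_nhds hε)).exists
    exact ⟨_, ENNReal.inv_pos.2 (ENNReal.natCast_ne_top n), hn⟩
  obtain ⟨ζ, hζ, hζδ⟩ := hU δ hδ
  have hm := h.memLp_b_smul (ν := ν) (hζ.continuous_gradient.memLp_of_hasCompactSupport
    (hasCompactSupport_gradient hζ.2))
  refine ⟨hm.toLp _, ⟨ζ, hζ, hm.coeFn_toLp⟩, ?_⟩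
  rw [edist_comm, Lp.edist_toLp_toLp]
  refine lt_of_le_of_lt ?_ hδε
  refine (eLpNorm_le_mul_eLpNorm_of_ae_le_mul (g := ∇ ζ - U) (ae_of_all _ fun x => ?_) 2).trans
    (by gcongr)
  rw [Pi.sub_apply, Pi.sub_apply, ← smul_sub, norm_smul]
  exact mul_le_mul_of_nonneg_right (hB _) (norm_nonneg _)

theorem Coefficients.isGradientLimit_chemicalGradient (h : Coefficients β b Φ)
    [IsFiniteMeasure ν] (hac : ν ≪ volume) (hb : MemLp (density ν) ⊤ volume) {Dv : Rd d → Rd d}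
    (hD : HasWeakGradient (density ν) Dv)
    (hlog : MemLp (fun x => (density ν x)⁻¹ • Dv x) 2 ν) :
    IsGradientLimit ν (chemicalGradient β b Φ ν Dv) := by
  obtain ⟨M, hM⟩ := exists_density_bound hb
  obtain ⟨L, -, hL⟩ := h.exists_ratio_bound
  have hle := measure_le_smul_volume hac hM
  exact (hD.isGradientLimit_log ENNReal.ofReal_ne_top hle hac (density_nonneg ν)
    (memLp_two_density hM) (hD.memLp_two_grad hac hM hlog) hlog h.continuous_ratio hL).add
    (h.isGradientLimit_potential ENNReal.ofReal_ne_top hle) (h.memLp_diffusion hlog).1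
    h.memLp_gradient.1

end WeightedGradient

end WeightedGradientFlow

end

theorem proposition3p11 {d : ℕ} (β b : ℝ → ℝ) (Φ : WeightedGradientFlow.Rd d → ℝ)
    (hcoef : WeightedGradientFlow.Coefficients β b Φ)
    (ν : Measure (WeightedGradientFlow.Rd d))
    (hν : ν ∈ WeightedGradientFlow.domainD0 Φ) :
    WeightedGradientFlow.MemDiffDomain (WeightedGradientFlow.energyDomain Φ)
        (WeightedGradientFlow.energy β b Φ) ν ∧
      (∃! w : Lp (WeightedGradientFlow.Rd d) 2 ν,
        WeightedGradientFlow.IsWeightedGradient (WeightedGradientFlow.energy β b Φ)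
          (WeightedGradientFlow.weight b) ν w) ∧
      ∀ w : Lp (WeightedGradientFlow.Rd d) 2 ν,
        WeightedGradientFlow.IsWeightedGradient (WeightedGradientFlow.energy β b Φ)
          (WeightedGradientFlow.weight b) ν w →
        w ∈ WeightedGradientFlow.weightedGradientFields b ν := by
  refine ⟨hcoef.memDiffDomain hν, ?_⟩
  obtain ⟨⟨hp, hac, hb, Dv, hD, hlog⟩, hE⟩ := hν
  have hW := hcoef.memLp_b_smul (hcoef.memLp_chemicalGradient hlog)
  have hgrad := hcoef.isWeightedGradient_toLp hE hD hlog hW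
  refine ⟨⟨_, hgrad, fun w hw => hcoef.isWeightedGradient_unique hac hw hgrad⟩, fun w hw => ?_⟩
  rw [hcoef.isWeightedGradient_unique hac hw hgrad]
  exact hcoef.toLp_mem_weightedGradientFields
    (hcoef.isGradientLimit_chemicalGradient hac hb hD hlog) hW
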